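/- **Setting.** A schema consists of finitely many relations, each with a finite set of attributes, together with functional dependencies (FDs) and inclusion dependencies. A *vertical decomposition* of a schema with one relation of attribute set $\bar A$ is a schema with relations $S_1(\bar B_1),\dots,S_r(\bar B_r)$ such that $\bar A=\bigcup_i\bar B_i$; both schemas have the same closure of FDs; $\bar C=\bigcap_i\bar B_i$ satisfies $\emptyset\ne\bar C\subsetneq\bar A$ and is a key of every $S_i$; and the inclusion dependencies $S_i[\bar C]=S_j[\bar C]$ ($i\neq j$) are in the schema. For a schema $\mathcal R$ and an integer $t\ge 0$, the targets are the function-free (and constant-free) Horn definitions over $\mathcal R$ of a new relation $T$ of arity $t$: finite sets of definite clauses whose heads are $T$-atoms and whose body atoms use relations of $\mathcal R$. An *interpretation* is a finite nonempty domain with a set of ground atoms over the relations of $\mathcal R$ and $T$ (it need not satisfy the dependencies); it is *positive* if it is a model of the universally quantified clauses of the target, and *negative* otherwise. A membership query asks whether an interpretation is positive. An equivalence query presents a set $H$ of clauses and is answered "yes" or by a counterexample, an interpretation on which $H$ and the target disagree. **The learner A2** keeps a sequence $s_1,s_2,\dots$ (initially empty) of negative interpretations and the positive counterexamples received so far. Its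 hypothesis consists of all clauses $b\leftarrow(\text{all true atoms of }s_i)$, where $b$ is an atom over the domain of $s_i$ that is false in $s_i$ and objects are read as variables, except the clauses that are false in a positive counterexample received so far. It asks an equivalence query with its hypothesis, and stops if the answer is "yes". A positive counterexample is stored. For a negative counterexample $x$, it first tries, with one membership query each, to drop the objects of $x$ one after the other (keeping the domain nonempty), dropping an object whenever the example stays negative. Then, for $i=1,2,\dots$, it goes through the pairings $J$ of $s_i$ and $x$ (for each one-to-one matching of the smaller of the two domains into the larger one: the objects of $J$ are the matched pairs, and an atom is true in $J$ if both its projections are true). For each $J$ with fewer true atoms than $s_i$ it asks a membership query; at the first negative such $J$ it replaces $s_i$ by $J$ and stops searching. If there is no such $J$ for any $i$, it appends $x$ to the sequence. Then it asks the next equivalence query. Let $Q_{\mathcal R}(t,m,k,n)$ be the largest total number of equivalence and membership queries that A2 asks, over all targets over $\mathcal R$ of arity $t$ with at most $m$ clauses and at most $k$ variables in each clause, and over all legal answers to the equivalence queries in which counterexamples have at most $n$ objects. Let $p_{\mathcal R}$ be the number of relations of $\mathcal R$ and $a_{\mathcal R}$ their largest arity. **Theorem.** For $l\ge 3$ let $\mathcal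 R_l$ be the schema with the single relation $R(A_1,\dots,A_l)$ and the FDs $A_1\to A_i$ ($2\le i\le l$), so that $p_{\mathcal R_l}=1$ and $a_{\mathcal R_l}=l$. Let $\mathcal S_l$ be the schema with the $l-1$ binary relations $S_i(A_1,A_i)$ ($2\le i\le l$), the FDs $A_1\to A_i$ and the inclusion dependencies $S_i[A_1]=S_j[A_1]$ ($i\ne j$), so that $p_{\mathcal S_l}=l-1$ and $a_{\mathcal S_l}=2$. Then $\mathcal S_l$ is a vertical decomposition of $\mathcal R_l$. Put $$f_l=m\,p_{\mathcal R_l}k^{a_{\mathcal R_l}}=m\,k^{l},\qquad g_l=m^2p_{\mathcal S_l}k^{a+3k}+n\,m\,p_{\mathcal S_l}k^{a+k},\quad p_{\mathcal S_l}=l-1,\quad a=\max(2,t).$$ 1. (Lower bound over $\mathcal R_l$.) There is an absolute constant $c_1$ such that for all $k\ge2$ and $m\ge1$, for all sufficiently large $l$ (depending on $k,m$), and for all $t\ge 0$ and $n\ge k$: $f_l\le c_1\,Q_{\mathcal R_l}(t,m,k,n)$. 2. (Upper bound over $\mathcal S_l$.) There is an absolute constant $c_2$ such that for all $k\ge2$,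 $m\ge1$, $l\ge3$, $t\ge0$ and $n\ge k$: $Q_{\mathcal S_l}(t,m,k,n)\le c_2\,g_l$. 3. (The lower bound asymptotically exceeds the upper bound.) For all fixed $k\ge2$, $m\ge1$, $t\ge0$ and $n\ge k$: $g_l=o(f_l)$ as $l\to\infty$. -/

import Mathlib

/-! ## Relational schemas and vertical decomposition -/

/-- An inclusion dependency `src[srcCols] ⊆ tgt[tgtCols]` between two relations. -/
structure InclDep (Rel : Type) where
  src : Rel
  srcCols : List ℕ
  tgt : Rel
  tgtCols : List ℕ

/-- A relational schema: finitely many relations, each with a finite set of attributes (attribute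
names are natural numbers), functional dependencies `X → Y` on each relation, and inclusion
dependencies. -/
structure Schema where
  Rel : Type
  fintypeRel : Fintype Rel
  decEqRel : DecidableEq Rel
  attrs : Rel → Finset ℕ
  fds : Rel → Set (Finset ℕ × Finset ℕ)
  inds : Set (InclDep Rel)
  fds_wf : ∀ r, ∀ f ∈ fds r, f.1 ⊆ attrs r ∧ f.2 ⊆ attrs r
  inds_wf : ∀ d ∈ inds, d.srcCols.length = d.tgtCols.length ∧
    (∀ A ∈ d.srcCols, A ∈ attrs d.src) ∧ (∀ A ∈ d.tgtCols, A ∈ attrs d.tgt)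

attribute [instance] Schema.fintypeRel Schema.decEqRel

/-- The closure of a set of functional dependencies (Armstrong's rules). -/
inductive FDClosure (F : Set (Finset ℕ × Finset ℕ)) : Finset ℕ → Finset ℕ → Prop
  | base {X Y : Finset ℕ} : (X, Y) ∈ F → FDClosure F X Y
  | refl {X Y : Finset ℕ} : Y ⊆ X → FDClosure F X Y
  | augment {X Y : Finset ℕ} (Z : Finset ℕ) : FDClosure F X Y → FDClosure F (X ∪ Z) (Y ∪ Z)
  | trans {X Y Z : Finset ℕ} : FDClosure F X Y → FDClosure F Y Z → FDClosure F X Z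

namespace Schema

/-- All functional dependencies of a schema. -/
def allFDs (S : Schema) : Set (Finset ℕ × Finset ℕ) := {f | ∃ r, f ∈ S.fds r}

/-- The number of relations of a schema. -/
def numRel (S : Schema) : ℕ := Fintype.card S.Rel

/-- The largest arity of a relation of a schema. -/
def maxArity (S : Schema) : ℕ := Finset.univ.sup fun r => (S.attrs r).card

/-- `S` is a vertical decomposition of the schema `R`, which has a single relation: the attribute
sets of `S` cover that of `R`; the two schemas have the same closure of functional dependencies; the
set `C` of attributes common to all relations of `S` is nonempty, is a proper subset of the
attributes of `R`, and is a key of every relation of `S`; and `S` contains the inclusion dependencies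
`S_i[C] = S_j[C]`. -/
def IsVerticalDecomposition (R S : Schema) : Prop :=
  ∃ r : R.Rel, (∀ r' : R.Rel, r' = r) ∧ Nonempty S.Rel ∧
    R.attrs r = Finset.univ.biUnion S.attrs ∧
    (∀ X Y : Finset ℕ, FDClosure R.allFDs X Y ↔ FDClosure S.allFDs X Y) ∧
    ∃ C : Finset ℕ, (∀ A, A ∈ C ↔ ∀ i : S.Rel, A ∈ S.attrs i) ∧
      C.Nonempty ∧ C ⊂ R.attrs r ∧
      (∀ i : S.Rel, FDClosure S.allFDs C (S.attrs i)) ∧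
      (∀ i j : S.Rel, i ≠ j →
        (⟨i, C.sort (· ≤ ·), j, C.sort (· ≤ ·)⟩ : InclDep S.Rel) ∈ S.inds)

end Schema

/-- One relation `R(A_0, …, A_{l-1})` with the functional dependencies `A_0 → A_i`, `1 ≤ i < l`. -/
def wideSchema (l : ℕ) : Schema where
  Rel := Unit
  fintypeRel := inferInstance
  decEqRel := inferInstance
  attrs _ := Finset.range l
  fds _ := {f | ∃ i, 1 ≤ i ∧ i < l ∧ f = ({0}, {i})}
  inds := ∅
  fds_wf := by
    rintro _ f ⟨i, h1, h2, rfl⟩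
    constructor <;> intro a ha <;> simp at ha ⊢ <;> omega
  inds_wf := by simp

/-- The binary relations `S_i(A_0, A_i)`, `1 ≤ i < l` (the relation `S_i` has index `i - 1`), with the
functional dependencies `A_0 → A_i` and the inclusion dependencies `S_i[A_0] = S_j[A_0]`. -/
def binarySchema (l : ℕ) : Schema where
  Rel := Fin (l - 1)
  fintypeRel := inferInstance
  decEqRel := inferInstance
  attrs i := {0, (i : ℕ) + 1}
  fds i := {({0}, {(i : ℕ) + 1})}
  inds := {d | ∃ i j, i ≠ j ∧ d = ⟨i, [0], j, [0]⟩}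
  fds_wf := by
    rintro i f hf
    simp only [Set.mem_singleton_iff] at hf
    subst hf
    simp
  inds_wf := by
    rintro d ⟨i, j, -, rfl⟩
    simp

/-! ## Function-free Horn expressions and their interpretations -/

/-- A finite relational signature. -/
structure Signature where
  Rel : Type
  fintypeRel : Fintype Rel
  decEqRel : DecidableEq Rel
  arity : Rel → ℕ

attribute [instance] Signature.fintypeRel Signature.decEqRel

/-- The signature of a schema together with a target relation (`none`) of arity `t`. -/
def Schema.signature (S : Schema) (t : ℕ) : Signature where
  Rel := Option S.Rel
  fintypeRel := inferInstance
  decEqRel := inferInstance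
  arity r := r.elim t fun r => (S.attrs r).card

/-- An atom without function or constant symbols. The arguments are natural numbers, read as
variables in clauses and as objects in interpretations. -/
abbrev Atom (σ : Signature) : Type := Σ r : σ.Rel, (Fin (σ.arity r) → ℕ)

namespace Atom

/-- Apply a substitution to an atom. -/
def map {σ : Signature} (θ : ℕ → ℕ) (a : Atom σ) : Atom σ := ⟨a.1, fun i => θ (a.2 i)⟩

/-- The arguments that occur in an atom. -/
def args {σ : Signature} (a : Atom σ) : Finset ℕ := Finset.univ.image a.2

end Atom

/-- A definite Horn clause `head ← body`. -/
structure Clause (σ : Signature) where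
  body : Finset (Atom σ)
  head : Atom σ

/-- The variables of a clause. -/
def Clause.vars {σ : Signature} (C : Clause σ) : Finset ℕ := C.body.biUnion Atom.args ∪ C.head.args

/-- A finite interpretation: a finite domain of objects and the set of true ground atoms. -/
structure Interp (σ : Signature) where
  dom : Finset ℕ
  atoms : Finset (Atom σ)
  wf : ∀ a ∈ atoms, a.args ⊆ dom

namespace Interp

variable {σ : Signature}

/-- The universal closure of the clause is true in the interpretation. -/
def Sat (x : Interp σ) (C : Clause σ) : Prop :=
  ∀ θ : ℕ → ℕ, (∀ v, θ v ∈ x.dom) → (∀ a ∈ C.body, a.map θ ∈ x.atoms) → C.head.map θ ∈ x.atoms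

/-- The interpretation is a model of a set of clauses. -/
def Models (x : Interp σ) (H : Set (Clause σ)) : Prop := ∀ C ∈ H, x.Sat C

/-- The size of an interpretation: its number of true atoms. -/
def size (x : Interp σ) : ℕ := x.atoms.card

/-- The substructure obtained by dropping the object `o`. -/
def drop (x : Interp σ) (o : ℕ) : Interp σ where
  dom := x.dom.erase o
  atoms := x.atoms.filter fun a => o ∉ a.args
  wf := by
    intro a ha b hb
    rw [Finset.mem_filter] at ha
    refine Finset.mem_erase.2 ⟨?_, x.wf a ha.1 hb⟩
    rintro rfl
    exact ha.2 hb

/-- The pairing of `s` and `x` along the matching of the `j`-th object of the list `ys` (objects of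
`s`) with the `j`-th object of the list `xs` (objects of `x`): its objects are the matched pairs,
and a ground atom is true in it when both its projections are true in `s` and in `x`. A matched pair
is named by its component in `s`. -/
def pairing (s x : Interp σ) (ys xs : List ℕ) : Interp σ where
  dom := s.dom.filter fun o => o ∈ ys
  atoms := s.atoms.filter fun a =>
    (∀ o ∈ a.args, o ∈ ys) ∧ a.map (fun o => xs.getD (ys.idxOf o) 0) ∈ x.atoms
  wf := by
    intro a ha b hb
    rw [Finset.mem_filter] at ha
    exact Finset.mem_filter.2 ⟨s.wf a ha.1 hb, ha.2.1 b hb⟩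

/-- All pairings of `s` and `x`: the matchings run over the one-to-one maps from the smaller of the
two domains into the larger one. -/
def pairings (s x : Interp σ) : List (Interp σ) :=
  let c := min s.dom.card x.dom.card
  ((s.dom.sort (· ≤ ·)).sublistsLen c).flatMap fun ys =>
    ys.permutations.flatMap fun ys' =>
      ((x.dom.sort (· ≤ ·)).sublistsLen c).map fun xs => s.pairing x ys' xs

end Interp

/-! ## The learner A2

The learner sees the target only through membership queries `mq`, where `mq x = true` means that `x`
is a positive example (a model of the target), and through the counterexamples to its equivalence
queries. The routines below return their result together with the number of membership queries. -/

namespace A2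

variable {σ : Signature}

/-- Shrink a negative example: try in turn to drop each listed object, as long as the example stays
negative (and its domain nonempty). -/
def minimise (mq : Interp σ → Bool) : List ℕ → Interp σ → Interp σ × ℕ
  | [], x => (x, 0)
  | o :: os, x =>
    if 1 < x.dom.card then
      if mq (x.drop o) = false then
        let r := minimise mq os (x.drop o)
        (r.1, r.2 + 1)
      else
        let r := minimise mq os x
        (r.1, r.2 + 1)
    else (x, 0)

/-- Look for the first candidate that is smaller than `s` and negative. -/
def firstSmallerNegative (mq : Interp σ → Bool) (s : Interp σ) :
    List (Interp σ) → Option (Interp σ) × ℕ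
  | [] => (none, 0)
  | J :: Js =>
    if J.size < s.size then
      if mq J = false then (some J, 1)
      else
        let r := firstSmallerNegative mq s Js
        (r.1, r.2 + 1)
    else firstSmallerNegative mq s Js

/-- Replace the first `s` in the sequence that has a smaller negative pairing with `x` by that
pairing; if there is none, append `x` to the sequence. -/
def refine (mq : Interp σ → Bool) (x : Interp σ) : List (Interp σ) → List (Interp σ) × ℕ
  | [] => ([x], 0)
  | s :: ss =>
    match firstSmallerNegative mq s (s.pairings x) with
    | (some J, c) => (J :: ss, c)
    | (none, c) =>
      let r := refine mq x ss
      (s :: r.1, c + r.2)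

/-- The state of the learner: the sequence of negative examples from which the hypothesis is built,
and the positive counterexamples received so far. -/
structure State (σ : Signature) where
  neg : List (Interp σ)
  pos : List (Interp σ)

/-- The hypothesis of a state. Each negative example `s` contributes the clauses
`b ← (all true atoms of s)`, for every atom `b` over the objects of `s` that is false in `s`, with
the objects turned into variables; the clauses refuted by a positive counterexample are removed. -/
def State.hyp (st : State σ) : Set (Clause σ) :=
  {C | ∃ s ∈ st.neg, C.body = s.atoms ∧ C.head.args ⊆ s.dom ∧ C.head ∉ s.atoms ∧
    ∀ y ∈ st.pos, y.Sat C}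

open Classical in
/-- Process a counterexample `x` to the equivalence query `EQ(st.hyp)`. If the hypothesis is true in
`x`, then `x` is a negative example, which is shrunk and used for refinement; otherwise it is a
positive example. Returns the new state and the number of membership queries. -/
noncomputable def State.next (mq : Interp σ → Bool) (st : State σ) (x : Interp σ) : State σ × ℕ :=
  if x.Models st.hyp then
    let r := minimise mq (x.dom.sort (· ≤ ·)) x
    let r' := refine mq r.1 st.neg
    (⟨r'.1, st.pos⟩, r.2 + r'.2)
  else (⟨st.neg, x :: st.pos⟩, 0)

open Classical in
/-- The membership oracle of a target. -/
noncomputable def memOracle (T : Finset (Clause σ)) (x : Interp σ) : Bool :=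
  decide (x.Models (T : Set (Clause σ)))

/-- A legal answer of the equivalence oracle, other than "yes": an interpretation with at least one
and at most `n` objects on which hypothesis and target disagree. -/
def IsCounterexample (T : Finset (Clause σ)) (n : ℕ) (H : Set (Clause σ)) (x : Interp σ) : Prop :=
  x.dom.Nonempty ∧ x.dom.card ≤ n ∧ ¬ (x.Models H ↔ x.Models (T : Set (Clause σ)))

/-- `Reaches T n st q`: for some legal answers of the equivalence oracle for the target `T`, the
learner gets from the empty state to the state `st` with `q` queries (equivalence queries plus
membership queries). -/
inductive Reaches (T : Finset (Clause σ)) (n : ℕ) : State σ → ℕ → Prop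
  | start : Reaches T n ⟨[], []⟩ 0
  | step {st : State σ} {q : ℕ} {x : Interp σ} :
      Reaches T n st q → IsCounterexample T n st.hyp x →
      Reaches T n (st.next (memOracle T) x).1 (q + 1 + (st.next (memOracle T) x).2)

end A2

/-- The Horn definitions, over a schema, of a target relation of arity `t`, that have at most `m`
clauses with at most `k` variables each: every head is a target atom, and every body atom is an atom
of the schema. -/
def hornDefinitions (S : Schema) (t m k : ℕ) : Set (Finset (Clause (S.signature t))) :=
  {T | T.card ≤ m ∧ ∀ C ∈ T,
    C.head.1 = none ∧ (∀ a ∈ C.body, a.1 ≠ none) ∧ C.vars.card ≤ k}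

/-- The worst-case number of queries of A2 over the schema `S`, for all target definitions with at
most `m` clauses and at most `k` variables per clause, and for all equivalence oracles whose
counterexamples have at most `n` objects. A run that has reached a state after `q` queries asks one
more equivalence query there, be it the one that is answered "yes". The value is `⊤` if the number
of queries is unbounded. -/
noncomputable def queryComplexityA2 (S : Schema) (t m k n : ℕ) : ℕ∞ :=
  ⨆ T ∈ hornDefinitions S t m k,
    ⨆ (st : A2.State (S.signature t)) (q : ℕ) (_ : A2.Reaches T n st q), ((q + 1 : ℕ) : ℕ∞)

/-- The lower bound `m p k^a`. -/
def lowerBoundA2 (S : Schema) (m k : ℕ) : ℕ := m * S.numRel * k ^ S.maxArity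

/-- The upper bound `m² p k^(a+3k) + n m p k^(a+k)`, where `a` is the largest arity of a relation of
the schema or of the target relation. -/
def upperBoundA2 (S : Schema) (t m k n : ℕ) : ℕ :=
  m ^ 2 * S.numRel * k ^ (max S.maxArity t + 3 * k) + n * m * S.numRel * k ^ (max S.maxArity t + k)

/-! The upper bound comes from a potential argument that works for every schema with at least one
relation. A negative example violates some target clause under some substitution, and only the
kernel of that substitution (which variables it identifies) matters. If an entry `s` of the sequence
covers a target clause that a later entry violates with the same kernel, the two substitutions
induce a matching whose pairing is again negative. Either that pairing is smaller than `s`, and A2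
would have used it, or it has all atoms of `s`, and then the later example violates a hypothesis
clause (`uncovered_of_noSmallerNegative`). Hence distinct entries have distinct pairs (clause,
kernel), and the sequence has at most `m * k ^ k` entries (`length_le_of_pairwise_uncovered`).

Each entry weighs its number of true atoms plus the number of atoms not yet refuted as heads, and
each unused place in the sequence weighs slightly more than any entry can. Every counterexample
lowers the total (`potential_next_lt`), and processing one costs at most `n` drops and `k ^ k`
pairings per entry. The product of the two bounds is `reaches_count_le`.

For the lower bound, A2 does not know that relations of the schema never occur in heads. The target
has `m` clauses, each with one wide body atom listing all `k` variables and a marker in a position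
of its own. The oracle first supplies these bodies as negative examples, whose pairings with each
other are empty (`reaches_patternInterps`). The hypothesis then has about `k ^ l` useless heads for
each body, and the oracle can refute those whose head is not a pattern instance one at a time
(`posInterp_sat_iff`, `reaches_posInterps`). Only `m * k ^ k` atoms are pattern instances, which is
negligible for large `l`.

The comparison is then that of a function linear in `l` with an exponential one: binary relations
leave only about `l * k ^ 2` possible atoms over the schema, against `k ^ l` for the wide one. -/

/-! ## Atoms, induced substructures and violated clauses -/

namespace Atom

variable {σ : Signature}

theorem mem_args {a : Atom σ} {v : ℕ} : v ∈ a.args ↔ ∃ i, a.2 i = v := by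
  simp [args]

theorem args_subset_iff {a : Atom σ} {D : Finset ℕ} : a.args ⊆ D ↔ ∀ i, a.2 i ∈ D := by
  simp [args, Finset.subset_iff]

theorem args_map (θ : ℕ → ℕ) (a : Atom σ) : (a.map θ).args = a.args.image θ := by
  simp only [args, map, Finset.image_image]
  rfl

theorem map_congr {θ η : ℕ → ℕ} {a : Atom σ} (h : ∀ v ∈ a.args, θ v = η v) :
    a.map θ = a.map η := by
  unfold map
  congr 1
  funext i
  exact h _ (mem_args.2 ⟨i, rfl⟩)

theorem map_eq_self {θ : ℕ → ℕ} {a : Atom σ} (h : ∀ v ∈ a.args, θ v = v) : a.map θ = a :=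
  (map_congr (η := id) h).trans rfl

end Atom

theorem Clause.args_subset_vars {σ : Signature} {C : Clause σ} {a : Atom σ} (ha : a ∈ C.body) :
    a.args ⊆ C.vars :=
  (Finset.subset_biUnion_of_mem Atom.args ha).trans Finset.subset_union_left

theorem Clause.head_args_subset_vars {σ : Signature} (C : Clause σ) : C.head.args ⊆ C.vars :=
  Finset.subset_union_right

namespace Interp

variable {σ : Signature}

/-- `x` is the substructure of `y` induced on the domain of `x`. -/
def IsInduced (x y : Interp σ) : Prop :=
  x.dom ⊆ y.dom ∧ ∀ a, a ∈ x.atoms ↔ a ∈ y.atoms ∧ a.args ⊆ x.dom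

theorem IsInduced.refl (x : Interp σ) : x.IsInduced x :=
  ⟨subset_rfl, fun a => ⟨fun h => ⟨h, x.wf a h⟩, fun h => h.1⟩⟩

theorem IsInduced.trans {x y z : Interp σ} (h : x.IsInduced y) (h' : y.IsInduced z) :
    x.IsInduced z := by
  refine ⟨h.1.trans h'.1, fun a => ?_⟩
  rw [h.2, h'.2]
  exact ⟨fun H => ⟨H.1.1, H.2⟩, fun H => ⟨⟨H.1, H.2.trans h.1⟩, H.2⟩⟩

theorem drop_isInduced (x : Interp σ) (o : ℕ) : (x.drop o).IsInduced x := by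
  refine ⟨Finset.erase_subset _ _, fun a => ?_⟩
  simp only [drop, Finset.mem_filter, and_congr_right_iff]
  intro ha
  rw [Finset.subset_erase]
  exact ⟨fun h => ⟨x.wf a ha, h⟩, fun h => h.2⟩

theorem IsInduced.drop {x y : Interp σ} (h : x.IsInduced y) (o : ℕ) :
    (x.drop o).IsInduced (y.drop o) := by
  refine ⟨Finset.erase_subset_erase o h.1, fun a => ?_⟩
  rw [((drop_isInduced x o).trans h).2, (drop_isInduced y o).2]
  exact ⟨fun H => ⟨⟨H.1, H.2.trans (Finset.erase_subset_erase o h.1)⟩, H.2⟩,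
    fun H => ⟨H.1.1, H.2⟩⟩

theorem IsInduced.sat {x y : Interp σ} (h : x.IsInduced y) {C : Clause σ} (hy : y.Sat C) :
    x.Sat C := fun θ hθ hb =>
  (h.2 _).2 ⟨hy θ (fun v => h.1 (hθ v)) fun a ha => ((h.2 _).1 (hb a ha)).1,
    Atom.args_subset_iff.2 fun _ => hθ _⟩

theorem IsInduced.models {x y : Interp σ} (h : x.IsInduced y) {H : Set (Clause σ)}
    (hy : y.Models H) : x.Models H := fun C hC => h.sat (hy C hC)

/-- The substitution maps the variables of the clause into the domain and its body into the true
atoms. -/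
def Covers (x : Interp σ) (C : Clause σ) (θ : ℕ → ℕ) : Prop :=
  (∀ v ∈ C.vars, θ v ∈ x.dom) ∧ ∀ a ∈ C.body, a.map θ ∈ x.atoms

/-- The clause is false under the substitution. -/
def Violates (x : Interp σ) (C : Clause σ) (θ : ℕ → ℕ) : Prop :=
  x.Covers C θ ∧ C.head.map θ ∉ x.atoms

theorem exists_violates {x : Interp σ} {H : Set (Clause σ)} (h : ¬ x.Models H) :
    x.dom.Nonempty ∧ ∃ C ∈ H, ∃ θ, x.Violates C θ := by
  simp only [Models, Sat] at h
  push Not at h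
  obtain ⟨C, hC, θ, hθ, hb, hh⟩ := h
  exact ⟨⟨_, hθ 0⟩, C, hC, θ, ⟨fun v _ => hθ v, hb⟩, hh⟩

/-- `Sat` ranges over substitutions that send every variable into the domain, while `Violates`
constrains only the variables of the clause. The other variables are sent to an arbitrary object, so
the domain has to be nonempty. -/
theorem Violates.not_sat {x : Interp σ} {C : Clause σ} {θ : ℕ → ℕ} (h : x.Violates C θ)
    (hx : x.dom.Nonempty) : ¬ x.Sat C := by
  classical
  obtain ⟨o, ho⟩ := hx
  intro hs
  have key : ∀ a : Atom σ, a.args ⊆ C.vars →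
      a.map (fun v => if v ∈ C.vars then θ v else o) = a.map θ := fun a ha =>
    Atom.map_congr fun v hv => if_pos (ha hv)
  refine h.2 ?_
  rw [← key _ C.head_args_subset_vars]
  refine hs _ (fun v => ?_) fun a ha => ?_
  · split_ifs with hv
    exacts [h.1.1 v hv, ho]
  · rw [key a (Clause.args_subset_vars ha)]
    exact h.1.2 a ha

theorem Violates.not_models {x : Interp σ} {C : Clause σ} {θ : ℕ → ℕ} (h : x.Violates C θ)
    (hx : x.dom.Nonempty) {H : Set (Clause σ)} (hC : C ∈ H) : ¬ x.Models H :=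
  fun hm => h.not_sat hx (hm C hC)

end Interp

/-! ## Pairings -/

namespace Interp

variable {σ : Signature}

/-- `J` is the pairing of `s` and `x` along the partial matching `μ`, defined on the domain
of `J`. -/
structure IsPairing (s x J : Interp σ) (μ : ℕ → ℕ) : Prop where
  dom_subset : J.dom ⊆ s.dom
  injOn : Set.InjOn μ J.dom
  mapsTo : ∀ o ∈ J.dom, μ o ∈ x.dom
  mem_atoms : ∀ a, a ∈ J.atoms ↔ a ∈ s.atoms ∧ a.args ⊆ J.dom ∧ a.map μ ∈ x.atoms

theorem pairing_isPairing {s x : Interp σ} {ys xs : List ℕ}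
    (hys : ∀ o ∈ ys, o ∈ s.dom) (hxs : ∀ o ∈ xs, o ∈ x.dom) (hx : xs.Nodup)
    (hlen : ys.length = xs.length) :
    IsPairing s x (s.pairing x ys xs) fun o => xs.getD (ys.idxOf o) 0 := by
  have hdom : ∀ o, o ∈ (s.pairing x ys xs).dom ↔ o ∈ ys := fun o => by
    simp only [pairing, Finset.mem_filter]
    exact ⟨fun h => h.2, fun h => ⟨hys o h, h⟩⟩
  have hlt : ∀ o ∈ ys, ys.idxOf o < xs.length := fun o ho =>
    hlen ▸ List.idxOf_lt_length_iff.2 ho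
  refine ⟨Finset.filter_subset _ _, ?_, ?_, ?_⟩
  · intro o ho o' ho' h
    rw [Finset.mem_coe, hdom] at ho ho'
    dsimp only at h
    rw [List.getD_eq_getElem _ _ (hlt o ho), List.getD_eq_getElem _ _ (hlt o' ho'),
      hx.getElem_inj_iff] at h
    exact (List.idxOf_inj ho).1 h
  · intro o ho
    rw [hdom] at ho
    rw [List.getD_eq_getElem _ _ (hlt o ho)]
    exact hxs _ (List.getElem_mem _)
  · intro a
    simp only [Finset.subset_iff, hdom]
    simp only [pairing, Finset.mem_filter]

theorem exists_isPairing_of_mem {s x J : Interp σ} (hJ : J ∈ s.pairings x) :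
    ∃ μ, IsPairing s x J μ := by
  simp only [pairings, List.mem_flatMap, List.mem_map, List.mem_sublistsLen,
    List.mem_permutations] at hJ
  obtain ⟨ys, ⟨hys, hc⟩, ys', hp, xs, ⟨hxs, hc'⟩, rfl⟩ := hJ
  refine ⟨_, pairing_isPairing (fun o ho => ?_) (fun o ho => ?_)
    (hxs.nodup (Finset.sort_nodup _ _)) (by rw [hp.length_eq, hc, hc'])⟩
  · exact (Finset.mem_sort _).1 (hys.subset (hp.mem_iff.1 ho))
  · exact (Finset.mem_sort _).1 (hxs.subset ho)

theorem sort_sublist_sort {X Y : Finset ℕ} (h : X ⊆ Y) :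
    (X.sort (· ≤ ·)).Sublist (Y.sort (· ≤ ·)) := by
  refine List.sublist_of_subperm_of_pairwise (r := (· ≤ ·)) ?_ (Finset.pairwise_sort _ _)
    (Finset.pairwise_sort _ _)
  refine (Finset.sort_nodup _ _).subperm fun a ha => ?_
  rw [Finset.mem_sort] at ha ⊢
  exact h ha

/-- The matching to be realised comes from two substitutions and is only partial, whereas A2
enumerates full matchings of the smaller domain. Both sides are enlarged to the common size `c`, and
the partial bijection is extended to a bijection between them. -/
theorem exists_pairing_extending {s x : Interp σ} {D : Finset ℕ} {f : ℕ → ℕ} (hD : D ⊆ s.dom)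
    (hf : Set.InjOn f D) (hfx : ∀ d ∈ D, f d ∈ x.dom) :
    ∃ J ∈ s.pairings x, ∃ μ, IsPairing s x J μ ∧ D ⊆ J.dom ∧ (∀ d ∈ D, μ d = f d) ∧
      J.dom.card = min s.dom.card x.dom.card := by
  classical
  set c := min s.dom.card x.dom.card with hcdef
  have hfD : (D.image f).card = D.card := Finset.card_image_of_injOn hf
  have hfD' : D.image f ⊆ x.dom := Finset.image_subset_iff.2 hfx
  have hDc : D.card ≤ c := le_min (Finset.card_le_card hD) (hfD ▸ Finset.card_le_card hfD')
  obtain ⟨Y, hDY, hYs, hY⟩ := Finset.exists_subsuperset_card_eq hD hDc (min_le_left _ _)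
  obtain ⟨X, hDX, hXx, hX⟩ :=
    Finset.exists_subsuperset_card_eq hfD' (hfD.trans_le hDc) (min_le_right _ _)
  obtain ⟨g, hg⟩ := Finset.exists_equiv_extend_of_card_eq (α := Y) (t := X)
    (by rw [Fintype.card_coe, hX, hY]) (s := Finset.univ.filter fun y : Y => (y : ℕ) ∈ D)
    (f := fun y => f y)
    (by
      intro v hv
      simp only [Finset.mem_image, Finset.mem_filter, Finset.mem_univ, true_and] at hv
      obtain ⟨y, hy, rfl⟩ := hv
      exact hDX (Finset.mem_image_of_mem f hy))
    (by
      intro y hy y' hy' h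
      simp only [Finset.coe_filter, Finset.mem_univ, true_and, Set.mem_ofPred_eq] at hy hy'
      exact Subtype.ext (hf hy hy' h))
  -- The inverse of the extended matching. The enumeration keeps the objects of `x` sorted and
  -- permutes those of `s`, so `ys` has to be the image of the sorted list `xs` under the inverse.
  let h : ℕ → ℕ := fun v => if hv : v ∈ X then (g.symm ⟨v, hv⟩ : ℕ) else 0
  have hh : ∀ v (hv : v ∈ X), h v = (g.symm ⟨v, hv⟩ : ℕ) := fun v hv => dif_pos hv
  have hhY : ∀ v ∈ X, h v ∈ Y := fun v hv => by rw [hh v hv]; exact (g.symm ⟨v, hv⟩).2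
  have hinj : Set.InjOn h X := by
    intro v hv w hw e
    rw [hh v hv, hh w hw] at e
    simpa using g.symm.injective (Subtype.ext e)
  have hgY : ∀ y (hy : y ∈ Y), h (g ⟨y, hy⟩) = y := fun y hy => by
    rw [hh _ (g ⟨y, hy⟩).2]
    simp
  let xs := X.sort (· ≤ ·)
  have hxsX : ∀ v, v ∈ xs ↔ v ∈ X := fun v => Finset.mem_sort _
  have hxs : xs.Nodup := Finset.sort_nodup _ _
  let ys := xs.map h
  have hysY : ∀ v, v ∈ ys ↔ v ∈ Y := by
    intro v
    simp only [ys, List.mem_map, hxsX]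
    constructor
    · rintro ⟨w, hw, rfl⟩
      exact hhY w hw
    · exact fun hv => ⟨g ⟨v, hv⟩, (g ⟨v, hv⟩).2, hgY v hv⟩
  have hys : ys.Nodup := by
    refine List.Nodup.map_on (fun v hv w hw e => ?_) hxs
    exact hinj ((hxsX v).1 hv) ((hxsX w).1 hw) e
  have hperm : ys.Perm (Y.sort (· ≤ ·)) := by
    rw [List.perm_ext_iff_of_nodup hys (Finset.sort_nodup _ _)]
    intro v
    rw [hysY, Finset.mem_sort]
  have hJdom : (s.pairing x ys xs).dom = Y := by
    ext o
    simp only [pairing, Finset.mem_filter, hysY]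
    exact ⟨fun H => H.2, fun H => ⟨hYs H, H⟩⟩
  refine ⟨s.pairing x ys xs, ?_, _, pairing_isPairing (fun o ho => hYs ((hysY o).1 ho))
    (fun o ho => hXx ((hxsX o).1 ho)) hxs (List.length_map _), hJdom.symm ▸ hDY, ?_, ?_⟩
  · simp only [pairings, List.mem_flatMap, List.mem_map, List.mem_sublistsLen,
      List.mem_permutations]
    refine ⟨Y.sort (· ≤ ·), ⟨sort_sublist_sort hYs, ?_⟩, ys, hperm, xs,
      ⟨sort_sublist_sort hXx, ?_⟩, rfl⟩
    · rw [Finset.length_sort, hY]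
    · rw [Finset.length_sort, hX]
  · intro d hd
    have hdY := hDY hd
    have hgd : (g ⟨d, hdY⟩ : ℕ) = f d := hg _ (by simpa using hd)
    have hfX : f d ∈ xs := (hxsX _).2 (hgd ▸ (g ⟨d, hdY⟩).2)
    have hfd : h (f d) = d := by rw [← hgd, hgY]
    have hlt : xs.idxOf (f d) < xs.length := List.idxOf_lt_length_iff.2 hfX
    have hidx : ys.idxOf d = xs.idxOf (f d) := by
      have hlt' : xs.idxOf (f d) < ys.length := by rwa [List.length_map]
      have : ys[xs.idxOf (f d)] = d := by
        simp only [ys, List.getElem_map, List.getElem_idxOf, hfd]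
      conv_lhs => rw [← this]
      exact hys.idxOf_getElem _ _
    rw [hidx, List.getD_eq_getElem _ _ hlt, List.getElem_idxOf]
  · rw [hJdom, hY]

/-- The number of matchings is a product of two binomial coefficients and a factorial. One
coefficient is 1 because `c` is the smaller size, and the rest is a falling factorial. -/
theorem length_pairings_le {s x : Interp σ} {k : ℕ} (hk : 1 ≤ k) (hs : s.dom.card ≤ k)
    (hx : x.dom.card ≤ k) : (s.pairings x).length ≤ k ^ k := by
  have hlen : (s.pairings x).length = s.dom.card.choose (min s.dom.card x.dom.card) *
      ((min s.dom.card x.dom.card).factorial *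
        x.dom.card.choose (min s.dom.card x.dom.card)) := by
    unfold pairings
    dsimp only
    set c := min s.dom.card x.dom.card
    rw [List.length_flatMap]
    rw [List.map_congr_left (g := fun _ => c.factorial * x.dom.card.choose c), List.map_const',
      List.sum_replicate, List.length_sublistsLen, Finset.length_sort, smul_eq_mul]
    intro ys hys
    rw [List.length_flatMap]
    simp only [List.length_map, List.length_sublistsLen, Finset.length_sort, List.map_const',
      List.sum_replicate, smul_eq_mul, List.length_permutations, (List.mem_sublistsLen.1 hys).2]
  have key : ∀ a b : ℕ, a ≤ b → b ≤ k → a.factorial * b.choose a ≤ k ^ k := by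
    intro a b hab hb
    rw [← Nat.descFactorial_eq_factorial_mul_choose]
    exact (Nat.descFactorial_le_pow b a).trans
      ((Nat.pow_le_pow_left hb a).trans (Nat.pow_le_pow_right hk (hab.trans hb)))
  rw [hlen]
  rcases le_total s.dom.card x.dom.card with h | h
  · rw [min_eq_left h, Nat.choose_self, one_mul]
    exact key _ _ h hx
  · rw [min_eq_right h, Nat.choose_self, mul_one, mul_comm]
    exact key _ _ h hs

end Interp

/-! ## The subroutines of the learner -/

namespace A2

variable {σ : Signature}

theorem memOracle_eq_true {T : Finset (Clause σ)} {x : Interp σ} :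
    memOracle T x = true ↔ x.Models (T : Set (Clause σ)) := by
  simp [memOracle]

theorem memOracle_eq_false {T : Finset (Clause σ)} {x : Interp σ} :
    memOracle T x = false ↔ ¬ x.Models (T : Set (Clause σ)) := by
  simp [memOracle]

theorem minimise_count_le (mq : Interp σ → Bool) (os : List ℕ) (x : Interp σ) :
    (minimise mq os x).2 ≤ os.length := by
  induction os generalizing x with
  | nil => simp [minimise]
  | cons o os ih =>
    simp only [minimise, List.length_cons]
    split_ifs
    · simpa using ih _
    · simpa using ih _
    · simp

theorem minimise_eq_self {mq : Interp σ → Bool} {os : List ℕ} {x : Interp σ}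
    (h : ∀ o ∈ os, mq (x.drop o) = true) : (minimise mq os x).1 = x := by
  induction os with
  | nil => rfl
  | cons o os ih =>
    simp only [minimise, h o List.mem_cons_self]
    split_ifs
    · exact absurd ‹_› (by simp)
    · exact ih fun o ho => h o (List.mem_cons_of_mem _ ho)
    · rfl

theorem minimise_isInduced (mq : Interp σ → Bool) (os : List ℕ) (x : Interp σ) :
    (minimise mq os x).1.IsInduced x := by
  induction os generalizing x with
  | nil => exact .refl x
  | cons o os ih =>
    simp only [minimise]
    split_ifs
    · exact (ih _).trans (x.drop_isInduced o)
    · exact ih _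
    · exact .refl x

theorem minimise_negative {mq : Interp σ → Bool} (os : List ℕ) {x : Interp σ}
    (hx : mq x = false) : mq (minimise mq os x).1 = false := by
  induction os generalizing x with
  | nil => exact hx
  | cons o os ih =>
    simp only [minimise]
    split_ifs with h1 h2
    · exact ih h2
    · exact ih hx
    · exact hx

/-- Each object is tried only once. If the drop of `o` was positive when it was tried, it stays
positive afterwards: the final example with `o` dropped is an induced substructure of that drop, and
clauses are inherited by induced substructures. -/
theorem drop_minimise_models {T : Finset (Clause σ)} {os : List ℕ} {x : Interp σ} {o : ℕ}
    (ho : o ∈ os) (ho' : o ∈ (minimise (memOracle T) os x).1.dom)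
    (hc : 1 < (minimise (memOracle T) os x).1.dom.card) :
    ((minimise (memOracle T) os x).1.drop o).Models (T : Set (Clause σ)) := by
  induction os generalizing x with
  | nil => simp at ho
  | cons p os ih =>
    simp only [minimise] at ho' hc ⊢
    split_ifs at ho' hc ⊢ with h1 h2
    · rcases List.mem_cons.1 ho with rfl | ho
      · have := (minimise_isInduced (memOracle T) os (x.drop o)).1 ho'
        simp [Interp.drop] at this
      · exact ih ho ho' hc
    · rcases List.mem_cons.1 ho with rfl | ho
      · exact ((minimise_isInduced _ os x).drop o).models
          (memOracle_eq_true.1 (by simpa using h2))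
      · exact ih ho ho' hc
    · exact absurd hc h1

/-- A violated clause uses at most `k` objects. With more than `k` objects left, some object outside
the image of the substitution could be dropped without losing the violation, contrary to minimality.
-/
theorem card_dom_minimise_le {T : Finset (Clause σ)} {k : ℕ} (hk : 1 ≤ k)
    (hT : ∀ C ∈ T, C.vars.card ≤ k) {x : Interp σ} (hx : ¬ x.Models (T : Set (Clause σ))) :
    (minimise (memOracle T) (x.dom.sort (· ≤ ·)) x).1.dom.card ≤ k := by
  have hind := minimise_isInduced (memOracle T) (x.dom.sort (· ≤ ·)) x
  have hneg := memOracle_eq_false.1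
    (minimise_negative (x.dom.sort (· ≤ ·)) (memOracle_eq_false.2 hx))
  have hdrop : ∀ o ∈ (minimise (memOracle T) (x.dom.sort (· ≤ ·)) x).1.dom,
      1 < (minimise (memOracle T) (x.dom.sort (· ≤ ·)) x).1.dom.card →
      ((minimise (memOracle T) (x.dom.sort (· ≤ ·)) x).1.drop o).Models (T : Set (Clause σ)) :=
    fun o ho => drop_minimise_models ((Finset.mem_sort _).2 (hind.1 ho)) ho
  generalize (minimise (memOracle T) (x.dom.sort (· ≤ ·)) x).1 = r at *
  by_contra! hr
  obtain ⟨-, C, hC, θ, hv⟩ := Interp.exists_violates hneg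
  obtain ⟨o, ho, ho'⟩ := Finset.exists_mem_notMem_of_card_lt_card
    (((Finset.card_image_le (s := C.vars) (f := θ)).trans (hT C hC)).trans_lt hr)
  have hmem : ∀ a : Atom σ, a.args ⊆ C.vars →
      (a.map θ ∈ (r.drop o).atoms ↔ a.map θ ∈ r.atoms) := by
    intro a ha
    simp only [Interp.drop, Finset.mem_filter, and_iff_left_iff_imp]
    intro _ hoa
    rw [Atom.args_map] at hoa
    exact ho' (Finset.image_subset_image ha hoa)
  have hv' : (r.drop o).Violates C θ := by
    refine ⟨⟨fun v hv1 => Finset.mem_erase.2 ⟨?_, hv.1.1 v hv1⟩, fun a ha => ?_⟩, ?_⟩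
    · rintro rfl
      exact ho' (Finset.mem_image_of_mem θ hv1)
    · exact (hmem a (Clause.args_subset_vars ha)).2 (hv.1.2 a ha)
    · rw [hmem _ C.head_args_subset_vars]
      exact hv.2
  refine hv'.not_models ?_ hC (hdrop o ho (by omega))
  rw [← Finset.card_pos]
  simp only [Interp.drop, Finset.card_erase_of_mem ho]
  omega

theorem firstSmallerNegative_count_le (mq : Interp σ → Bool) (s : Interp σ)
    (Js : List (Interp σ)) : (firstSmallerNegative mq s Js).2 ≤ Js.length := by
  induction Js with
  | nil => simp [firstSmallerNegative]
  | cons J Js ih =>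
    simp only [firstSmallerNegative, List.length_cons]
    split_ifs
    · simp
    · simpa using ih
    · omega

theorem firstSmallerNegative_some {mq : Interp σ → Bool} {s J : Interp σ} {Js : List (Interp σ)}
    (h : (firstSmallerNegative mq s Js).1 = some J) :
    J ∈ Js ∧ J.size < s.size ∧ mq J = false := by
  induction Js with
  | nil => simp [firstSmallerNegative] at h
  | cons J' Js ih =>
    simp only [firstSmallerNegative] at h
    split_ifs at h with h1 h2
    · obtain rfl : J' = J := by simpa using h
      exact ⟨List.mem_cons_self, h1, h2⟩
    · exact ⟨List.mem_cons_of_mem _ (ih h).1, (ih h).2⟩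
    · exact ⟨List.mem_cons_of_mem _ (ih h).1, (ih h).2⟩

theorem firstSmallerNegative_none {mq : Interp σ → Bool} {s : Interp σ} {Js : List (Interp σ)}
    (h : (firstSmallerNegative mq s Js).1 = none) :
    ∀ J ∈ Js, J.size < s.size → mq J = true := by
  induction Js with
  | nil => simp
  | cons J' Js ih =>
    simp only [firstSmallerNegative] at h
    intro J hJ hlt
    split_ifs at h with h1 h2
    · rcases List.mem_cons.1 hJ with rfl | hJ
      · simpa using h2
      · exact ih h J hJ hlt
    · rcases List.mem_cons.1 hJ with rfl | hJ
      · exact absurd hlt h1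
      · exact ih h J hJ hlt

/-- No pairing of `s` and `x` that is smaller than `s` is negative. -/
def NoSmallerNegative (mq : Interp σ → Bool) (s x : Interp σ) : Prop :=
  ∀ J ∈ s.pairings x, J.size < s.size → mq J = true

theorem refine_count_le {mq : Interp σ → Bool} {x : Interp σ} {ss : List (Interp σ)} {B : ℕ}
    (h : ∀ s ∈ ss, (s.pairings x).length ≤ B) : (refine mq x ss).2 ≤ ss.length * B := by
  induction ss with
  | nil => simp [refine]
  | cons s ss ih =>
    have h1 := (firstSmallerNegative_count_le mq s (s.pairings x)).trans (h s List.mem_cons_self)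
    have h2 := ih fun s hs => h s (List.mem_cons_of_mem _ hs)
    simp only [refine, List.length_cons, add_mul, one_mul]
    split <;> rename_i heq <;> simp only [heq] at h1 ⊢
    · exact h1.trans (Nat.le_add_left _ _)
    · rw [add_comm]
      exact Nat.add_le_add h2 h1

theorem refine_cases (mq : Interp σ → Bool) (x : Interp σ) (ss : List (Interp σ)) :
    (∃ L₁ s L₂ J, ss = L₁ ++ s :: L₂ ∧ (refine mq x ss).1 = L₁ ++ J :: L₂ ∧
      J ∈ s.pairings x ∧ J.size < s.size ∧ mq J = false ∧
      ∀ s' ∈ L₁, NoSmallerNegative mq s' x) ∨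
    ((refine mq x ss).1 = ss ++ [x] ∧ ∀ s ∈ ss, NoSmallerNegative mq s x) := by
  induction ss with
  | nil => exact Or.inr ⟨rfl, by simp⟩
  | cons s ss ih =>
    simp only [refine]
    split <;> rename_i heq
    · obtain ⟨h1, h2, h3⟩ := firstSmallerNegative_some (congrArg Prod.fst heq)
      exact Or.inl ⟨[], s, ss, _, rfl, rfl, h1, h2, h3, by simp⟩
    · have hs : NoSmallerNegative mq s x := firstSmallerNegative_none (congrArg Prod.fst heq)
      rcases ih with ⟨L₁, s', L₂, J, rfl, h2, h3, h4, h5, h6⟩ | ⟨h1, h2⟩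
      · refine Or.inl ⟨s :: L₁, s', L₂, J, rfl, by simp [h2], h3, h4, h5, ?_⟩
        simpa [hs] using h6
      · exact Or.inr ⟨by simp [h1], by simpa [hs] using h2⟩

theorem refine_eq_append {mq : Interp σ → Bool} {x : Interp σ} {ss : List (Interp σ)}
    (h : ∀ s ∈ ss, ∀ J ∈ s.pairings x, mq J = true) : (refine mq x ss).1 = ss ++ [x] := by
  rcases refine_cases mq x ss with ⟨L₁, s, L₂, J, rfl, -, hJ, -, hJ', -⟩ | ⟨h, -⟩
  · simp [h s (by simp) J hJ] at hJ'
  · exact h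

end A2

/-! ## The number of negative examples in the sequence -/

/-- The two substitutions identify the same variables of the clause. -/
def SameKernel {σ : Signature} (C : Clause σ) (θ η : ℕ → ℕ) : Prop :=
  ∀ v ∈ C.vars, ∀ w ∈ C.vars, θ v = θ w ↔ η v = η w

/-- The map that sends a variable of the clause to the least variable with the same image. -/
noncomputable def kernelMap {σ : Signature} (C : Clause σ) (θ : ℕ → ℕ) (v : C.vars) : C.vars :=
  have h : (C.vars.filter fun w => θ w = θ v).Nonempty := ⟨v, by simp⟩
  ⟨(C.vars.filter fun w => θ w = θ v).min' h,
    Finset.mem_of_mem_filter _ (Finset.min'_mem _ h)⟩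

theorem apply_kernelMap {σ : Signature} (C : Clause σ) (θ : ℕ → ℕ) (v : C.vars) :
    θ (kernelMap C θ v) = θ v :=
  (Finset.mem_filter.1 (Finset.min'_mem (C.vars.filter fun w => θ w = θ v) ⟨v, by simp⟩)).2

theorem kernelMap_eq_iff {σ : Signature} (C : Clause σ) (θ : ℕ → ℕ) (v w : C.vars) :
    kernelMap C θ v = kernelMap C θ w ↔ θ v = θ w := by
  constructor
  · intro h
    exact (apply_kernelMap C θ v).symm.trans (h ▸ apply_kernelMap C θ w)
  · intro h
    simp only [kernelMap, h]

/-- Kernels are thus recorded by self-maps of the variable set, of which there are at most `k ^ k`.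
-/
theorem sameKernel_of_kernelMap_eq {σ : Signature} {C : Clause σ} {θ η : ℕ → ℕ}
    (h : kernelMap C θ = kernelMap C η) : SameKernel C θ η := fun v hv w hw => by
  have h1 := kernelMap_eq_iff C θ ⟨v, hv⟩ ⟨w, hw⟩
  rw [h, kernelMap_eq_iff] at h1
  exact h1.symm

namespace A2

variable {σ : Signature}

/-- Whatever clause of the target is false in `x`, it is not covered by `s` under a substitution
with the same kernel. -/
def Uncovered (T : Finset (Clause σ)) (s x : Interp σ) : Prop :=
  ∀ C ∈ T, ∀ θ η, x.Violates C η → SameKernel C θ η → ¬ s.Covers C θ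

/-- The facts about a state of the learner that hold throughout a run. -/
structure Invariant (T : Finset (Clause σ)) (k : ℕ) (st : State σ) : Prop where
  negative : ∀ s ∈ st.neg, ¬ s.Models (T : Set (Clause σ))
  card_dom : ∀ s ∈ st.neg, s.dom.card ≤ k
  positive : ∀ y ∈ st.pos, y.Models (T : Set (Clause σ))
  uncovered : st.neg.Pairwise (Uncovered T)

/-- Each entry is assigned a violated clause together with the kernel of the violating substitution.
An entry covers what it violates, so two entries with the same pair would contradict `Uncovered`. -/
theorem length_le_of_pairwise_uncovered {T : Finset (Clause σ)} {m k : ℕ} (hk : 1 ≤ k)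
    (hm : T.card ≤ m) (hT : ∀ C ∈ T, C.vars.card ≤ k) {L : List (Interp σ)}
    (hL : ∀ s ∈ L, ¬ s.Models (T : Set (Clause σ))) (h : L.Pairwise (Uncovered T)) :
    L.length ≤ m * k ^ k := by
  classical
  rcases L.eq_nil_or_concat with rfl | ⟨L', z, rfl⟩
  · simp
  -- `choose!` needs a default clause; a nonempty list provides one.
  have : Nonempty (Clause σ) := ⟨(Interp.exists_violates (hL z (by simp))).2.choose⟩
  generalize L'.concat z = L at *
  choose! C hC using fun s hs => (Interp.exists_violates (hL s hs)).2
  have hCT : ∀ s ∈ L, C s ∈ T := fun s hs => (hC s hs).1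
  choose! θ hθ using fun s hs => (hC s hs).2
  -- `f` must be defined on all interpretations, including those whose chosen clause need not lie in
  -- `T`. The finite type of pairs over `T` is therefore embedded by `F` into the pairs over all
  -- clauses.
  let F : (Σ C : T, (C.1.vars → C.1.vars)) → (Σ C : Clause σ, (C.vars → C.vars)) :=
    fun p => ⟨p.1, p.2⟩
  let f : Interp σ → (Σ C : Clause σ, (C.vars → C.vars)) :=
    fun s => ⟨C s, kernelMap (C s) (θ s)⟩
  have hnd : (L.map f).Nodup := by
    rw [List.Nodup, List.pairwise_map]
    refine h.imp_of_mem fun {s s'} hs hs' huc e => ?_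
    have hK : SameKernel (C s') (θ s) (θ s') := by
      obtain ⟨e1, e2⟩ := Sigma.mk.inj_iff.1 e
      revert e2
      rw [← e1]
      intro e2
      exact sameKernel_of_kernelMap_eq (eq_of_heq e2)
    refine huc (C s') (hCT s' hs') (θ s) (θ s') (hθ s' hs') hK ?_
    rw [← (Sigma.mk.inj_iff.1 e).1]
    exact (hθ s hs).1
  calc L.length = (L.map f).toFinset.card := by
        rw [List.toFinset_card_of_nodup hnd, List.length_map]
    _ ≤ (Finset.univ.image F).card := by
        refine Finset.card_le_card fun p hp => ?_
        obtain ⟨s, hs, rfl⟩ := List.mem_map.1 (List.mem_toFinset.1 hp)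
        exact Finset.mem_image.2 ⟨⟨⟨C s, hCT s hs⟩, kernelMap (C s) (θ s)⟩,
          Finset.mem_univ _, rfl⟩
    _ ≤ Fintype.card (Σ C : T, (C.1.vars → C.1.vars)) := Finset.card_image_le
    _ = ∑ C : T, C.1.vars.card ^ C.1.vars.card := by
        rw [Fintype.card_sigma]
        refine Finset.sum_congr rfl fun C _ => ?_
        rw [Fintype.card_fun, Fintype.card_coe]
    _ ≤ ∑ _C : T, k ^ k := Finset.sum_le_sum fun C _ =>
        (Nat.pow_le_pow_left (hT C C.2) _).trans (Nat.pow_le_pow_right hk (hT C C.2))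
    _ ≤ m * k ^ k := by
        rw [Finset.sum_const, Finset.card_univ, Fintype.card_coe, smul_eq_mul]
        exact Nat.mul_le_mul_right _ hm

/-- If a negative example satisfies the hypothesis and has no smaller negative pairing with `s`,
then `s` does not cover a clause that the example violates. -/
theorem uncovered_of_noSmallerNegative {T : Finset (Clause σ)} {st : State σ} {s x : Interp σ}
    (hs : s ∈ st.neg) (hsneg : ¬ s.Models (T : Set (Clause σ)))
    (hpos : ∀ y ∈ st.pos, y.Models (T : Set (Clause σ)))
    (hx : x.dom.Nonempty) (hxhyp : x.Models st.hyp)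
    (hno : NoSmallerNegative (memOracle T) s x) : Uncovered T s x := by
  intro C hC θ η hviol hker hcov
  classical
  -- The matching `θ v ↦ η v`. Equality of kernels makes it both well defined and injective.
  let f : ℕ → ℕ := fun d => if h : ∃ v ∈ C.vars, θ v = d then η h.choose else 0
  have hf : ∀ v ∈ C.vars, f (θ v) = η v := by
    intro v hv
    have h : ∃ w ∈ C.vars, θ w = θ v := ⟨v, hv, rfl⟩
    have : f (θ v) = η h.choose := dif_pos h
    rw [this]
    exact (hker _ h.choose_spec.1 _ hv).1 h.choose_spec.2
  obtain ⟨J, hJ, μ, hp, hDJ, hμ, hcard⟩ := Interp.exists_pairing_extending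
    (s := s) (x := x) (D := C.vars.image θ) (f := f)
    (Finset.image_subset_iff.2 hcov.1)
    (by
      intro d hd e he h
      obtain ⟨v, hv, rfl⟩ := Finset.mem_image.1 hd
      obtain ⟨w, hw, rfl⟩ := Finset.mem_image.1 he
      rw [hf v hv, hf w hw] at h
      exact (hker v hv w hw).2 h)
    (by
      intro d hd
      obtain ⟨v, hv, rfl⟩ := Finset.mem_image.1 hd
      rw [hf v hv]
      exact hviol.1.1 v hv)
  have hμθ : ∀ v ∈ C.vars, μ (θ v) = η v := fun v hv => by
    rw [hμ _ (Finset.mem_image_of_mem θ hv), hf v hv]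
  have hmap : ∀ a : Atom σ, a.args ⊆ C.vars → (a.map θ).map μ = a.map η := fun a ha =>
    Atom.map_congr fun v hv => hμθ v (ha hv)
  have hargs : ∀ a : Atom σ, a.args ⊆ C.vars → (a.map θ).args ⊆ J.dom := fun a ha => by
    rw [Atom.args_map]
    exact (Finset.image_subset_image ha).trans hDJ
  have hhead : (C.head.map θ).map μ = C.head.map η := hmap _ C.head_args_subset_vars
  have hJhead : C.head.map θ ∉ J.atoms := fun h =>
    hviol.2 (hhead ▸ ((hp.mem_atoms _).1 h).2.2)
  have hJv : J.Violates C θ := by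
    refine ⟨⟨fun v hv => hDJ (Finset.mem_image_of_mem θ hv), fun a ha => ?_⟩, hJhead⟩
    have ha' := Clause.args_subset_vars ha
    refine (hp.mem_atoms _).2 ⟨hcov.2 a ha, hargs a ha', ?_⟩
    rw [hmap a ha']
    exact hviol.1.2 a ha
  have hJne : J.dom.Nonempty := by
    rw [← Finset.card_pos, hcard]
    exact lt_min (Finset.card_pos.2 (Interp.exists_violates hsneg).1) (Finset.card_pos.2 hx)
  have hJneg := hJv.not_models hJne (H := (T : Set (Clause σ))) hC
  -- `J` is negative, so it cannot be smaller than `s`; being a part of `s`, it then has the same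
  -- true atoms.
  have hsize : ¬ J.size < s.size := fun h => hJneg (memOracle_eq_true.1 (hno J hJ h))
  have hJs : J.atoms = s.atoms :=
    Finset.eq_of_subset_of_card_le (fun a ha => ((hp.mem_atoms a).1 ha).1) (not_lt.1 hsize)
  -- The clause is an instance of the target clause `C` with a possibly larger body, so no positive
  -- example refutes it. The contradiction is that `x` violates it through `μ`.
  have hmem : (⟨s.atoms, C.head.map θ⟩ : Clause σ) ∈ st.hyp := by
    refine ⟨s, hs, rfl, (hargs _ C.head_args_subset_vars).trans hp.dom_subset,
      hJs ▸ hJhead, fun y hy ζ hζ hb => ?_⟩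
    exact hpos y hy C hC (fun v => ζ (θ v)) (fun v => hζ _) fun a ha => hb _ (hcov.2 a ha)
  obtain ⟨o, ho⟩ := hx
  have hext : ∀ a : Atom σ, a.args ⊆ J.dom →
      a.map (fun v => if v ∈ J.dom then μ v else o) = a.map μ := fun a ha =>
    Atom.map_congr fun v hv => if_pos (ha hv)
  have := hxhyp _ hmem (fun v => if v ∈ J.dom then μ v else o) (fun v => by
    split_ifs with hv
    exacts [hp.mapsTo v hv, ho]) (fun a ha => by
    have h := (hp.mem_atoms a).1 (hJs.symm ▸ ha)
    rw [hext a h.2.1]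
    exact h.2.2)
  dsimp only at this
  rw [hext _ (hargs _ C.head_args_subset_vars), hhead] at this
  exact hviol.2 this

/-! ### Stability of the covering condition when an entry is replaced by a pairing -/

theorem Uncovered.of_isPairing_left {T : Finset (Clause σ)} {s x J z : Interp σ} {μ : ℕ → ℕ}
    (hp : Interp.IsPairing s x J μ) (h : Uncovered T s z) : Uncovered T J z :=
  fun C hC θ η hv hk hc => h C hC θ η hv hk
    ⟨fun v hv => hp.dom_subset (hc.1 v hv), fun a ha => ((hp.mem_atoms _).1 (hc.2 a ha)).1⟩

/-- A head missing from the pairing is missing from `s` or, after applying `μ`, from `x`. So one of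
the two violates the same clause, and the kernel is unchanged because `μ` is injective. -/
theorem Uncovered.isPairing_right {T : Finset (Clause σ)} {s x J z : Interp σ} {μ : ℕ → ℕ}
    (hp : Interp.IsPairing s x J μ) (hs : Uncovered T z s) (hx : Uncovered T z x) :
    Uncovered T z J := by
  intro C hC θ η hv hk
  by_cases hh : C.head.map η ∈ s.atoms
  · refine hx C hC θ (fun v => μ (η v)) ⟨⟨fun v hv' => hp.mapsTo _ (hv.1.1 v hv'), fun a ha =>
      ((hp.mem_atoms _).1 (hv.1.2 a ha)).2.2⟩, fun h => hv.2 ?_⟩ fun v hv' w hw' => ?_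
    · refine (hp.mem_atoms _).2 ⟨hh, ?_, h⟩
      rw [Atom.args_map, Finset.image_subset_iff]
      exact fun v hv' => hv.1.1 v (C.head_args_subset_vars hv')
    · rw [hk v hv' w hw']
      exact (hp.injOn.eq_iff (hv.1.1 v hv') (hv.1.1 w hw')).symm
  · exact hs C hC θ η ⟨⟨fun v hv' => hp.dom_subset (hv.1.1 v hv'), fun a ha =>
      ((hp.mem_atoms _).1 (hv.1.2 a ha)).1⟩, hh⟩ hk

/-! ## The potential of a state -/

/-- The atoms over a set of objects. -/
def atomsOver (σ : Signature) (D : Finset ℕ) : Finset (Atom σ) :=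
  Finset.univ.sigma fun _ => Fintype.piFinset fun _ => D

theorem mem_atomsOver {D : Finset ℕ} {a : Atom σ} : a ∈ atomsOver σ D ↔ a.args ⊆ D := by
  simp [atomsOver, Atom.args_subset_iff]

theorem card_atomsOver (D : Finset ℕ) :
    (atomsOver σ D).card = ∑ r : σ.Rel, D.card ^ σ.arity r := by
  simp [atomsOver]

open Classical in
/-- The atoms `b` over the domain of `s` such that no stored positive counterexample refutes the
clause `b ← (all true atoms of s)`. -/
noncomputable def live (pos : List (Interp σ)) (s : Interp σ) : Finset (Atom σ) :=
  (atomsOver σ s.dom).filter fun b => ∀ y ∈ pos, y.Sat ⟨s.atoms, b⟩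

theorem mem_live {pos : List (Interp σ)} {s : Interp σ} {b : Atom σ} :
    b ∈ live pos s ↔ b.args ⊆ s.dom ∧ ∀ y ∈ pos, y.Sat ⟨s.atoms, b⟩ := by
  simp [live, mem_atomsOver]

/-- The potential of one negative example. -/
noncomputable def weight (pos : List (Interp σ)) (s : Interp σ) : ℕ :=
  s.size + (live pos s).card

theorem weight_le (pos : List (Interp σ)) {s : Interp σ} {k : ℕ} (h : s.dom.card ≤ k) :
    weight pos s ≤ 2 * ∑ r : σ.Rel, k ^ σ.arity r := by
  have hA : (atomsOver σ s.dom).card ≤ ∑ r : σ.Rel, k ^ σ.arity r := by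
    rw [card_atomsOver]
    exact Finset.sum_le_sum fun r _ => Nat.pow_le_pow_left h _
  have h1 : s.size ≤ (atomsOver σ s.dom).card :=
    Finset.card_le_card fun a ha => mem_atomsOver.2 (s.wf a ha)
  have h2 : (live pos s).card ≤ (atomsOver σ s.dom).card :=
    Finset.card_le_card (by classical exact Finset.filter_subset _ _)
  unfold weight
  omega

/-- A pairing has a smaller body and hence a logically stronger clause for each head, so no head
that was refuted for `s` becomes live again. -/
theorem weight_lt_of_isPairing (pos : List (Interp σ)) {s x J : Interp σ} {μ : ℕ → ℕ}
    (hp : Interp.IsPairing s x J μ) (h : J.size < s.size) : weight pos J < weight pos s := by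
  refine add_lt_add_of_lt_of_le h (Finset.card_le_card fun b hb => ?_)
  rw [mem_live] at hb ⊢
  exact ⟨hb.1.trans hp.dom_subset, fun y hy θ hθ hs =>
    hb.2 y hy θ hθ fun a ha => hs a ((hp.mem_atoms a).1 ha).1⟩

theorem live_cons_subset (pos : List (Interp σ)) (x s : Interp σ) :
    live (x :: pos) s ⊆ live pos s := fun b hb => by
  rw [mem_live] at hb ⊢
  exact ⟨hb.1, fun y hy => hb.2 y (List.mem_cons_of_mem _ hy)⟩

/-- The potential of a state, when at most `N` negative examples with weight at most `w` can
occur. -/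
noncomputable def potential (N w : ℕ) (st : State σ) : ℕ :=
  (st.neg.map (weight st.pos)).sum + (N - st.neg.length) * (w + 1)

/-! ### Effect of one counterexample on the invariant and on the potential -/

theorem invariant_next {T : Finset (Clause σ)} {k n : ℕ} (hk : 1 ≤ k)
    (hT : ∀ C ∈ T, C.vars.card ≤ k) {st : State σ} (hst : Invariant T k st) {x : Interp σ}
    (hx : IsCounterexample T n st.hyp x) : Invariant T k (st.next (memOracle T) x).1 := by
  obtain ⟨hxne, -, hdis⟩ := hx
  unfold State.next
  split_ifs with hh
  · have hneg : ¬ x.Models (T : Set (Clause σ)) := fun h => hdis ⟨fun _ => h, fun _ => hh⟩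
    have hcard := card_dom_minimise_le hk hT hneg
    have hxind := minimise_isInduced (memOracle T) (x.dom.sort (· ≤ ·)) x
    have hneg' := memOracle_eq_false.1
      (minimise_negative (x.dom.sort (· ≤ ·)) (memOracle_eq_false.2 hneg))
    dsimp only
    generalize (minimise (memOracle T) (x.dom.sort (· ≤ ·)) x).1 = z at *
    have hzne : z.dom.Nonempty := (Interp.exists_violates hneg').1
    have hzh : z.Models st.hyp := hxind.models hh
    have hun : ∀ s ∈ st.neg, NoSmallerNegative (memOracle T) s z → Uncovered T s z :=
      fun s hs => uncovered_of_noSmallerNegative hs (hst.negative s hs) hst.positive hzne hzh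
    rcases refine_cases (memOracle T) z st.neg with
      ⟨L₁, s, L₂, J, h1, h2, h3, h4, h5, h6⟩ | ⟨h1, h2⟩
    · rw [h2]
      obtain ⟨μ, hp⟩ := Interp.exists_isPairing_of_mem h3
      obtain ⟨a1, a2, a3, a4⟩ := hst
      rw [h1] at a1 a2 a4
      simp only [List.forall_mem_append, List.forall_mem_cons] at a1 a2
      rw [List.pairwise_append, List.pairwise_cons] at a4
      have hJc := (Finset.card_le_card hp.dom_subset).trans a2.2.1
      refine ⟨?_, ?_, a3, ?_⟩
      · simp only [List.forall_mem_append, List.forall_mem_cons]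
        exact ⟨a1.1, memOracle_eq_false.1 h5, a1.2.2⟩
      · simp only [List.forall_mem_append, List.forall_mem_cons]
        exact ⟨a2.1, hJc, a2.2.2⟩
      · dsimp only
        rw [List.pairwise_append, List.pairwise_cons]
        refine ⟨a4.1, ⟨fun s' hs' => (a4.2.1.1 s' hs').of_isPairing_left hp, a4.2.1.2⟩,
          fun s' hs' t ht => ?_⟩
        rcases List.mem_cons.1 ht with rfl | ht
        -- This is where replacing the first possible entry matters: the entries before it are known
        -- to have no smaller negative pairing with `z`.
        · exact (a4.2.2 s' hs' s List.mem_cons_self).isPairing_right hp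
            (hun s' (by simp [h1, hs']) (h6 s' hs'))
        · exact a4.2.2 s' hs' t (List.mem_cons_of_mem _ ht)
    · rw [h1]
      refine ⟨?_, ?_, hst.positive, ?_⟩
      · simpa [or_imp, forall_and] using ⟨hst.negative, hneg'⟩
      · simpa [or_imp, forall_and] using ⟨hst.card_dom, hcard⟩
      · dsimp only
        rw [List.pairwise_append]
        refine ⟨hst.uncovered, List.pairwise_singleton _ _, fun s hs t ht => ?_⟩
        rw [List.mem_singleton.1 ht]
        exact hun s hs (h2 s hs)
  · have hpos : x.Models (T : Set (Clause σ)) := by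
      by_contra h
      exact hdis ⟨fun h' => absurd h' hh, fun h' => absurd h' h⟩
    refine ⟨hst.negative, hst.card_dom, ?_, hst.uncovered⟩
    simpa using ⟨hpos, hst.positive⟩

/-- A replacement lowers the weight of one entry. An appended entry weighs at most `w` and uses up a
place worth `w + 1`. A positive counterexample refutes a hypothesis clause, whose head stops being
live. -/
theorem potential_next_lt {T : Finset (Clause σ)} {k m n : ℕ} (hk : 1 ≤ k) (hm : T.card ≤ m)
    (hT : ∀ C ∈ T, C.vars.card ≤ k) {st : State σ} (hst : Invariant T k st) {x : Interp σ}
    (hx : IsCounterexample T n st.hyp x) :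
    potential (m * k ^ k) (2 * ∑ r : σ.Rel, k ^ σ.arity r) (st.next (memOracle T) x).1 <
      potential (m * k ^ k) (2 * ∑ r : σ.Rel, k ^ σ.arity r) st := by
  have hinv := invariant_next hk hT hst hx
  have hlen := length_le_of_pairwise_uncovered hk hm hT hinv.negative hinv.uncovered
  have hcd := hinv.card_dom
  clear hinv
  unfold potential
  unfold State.next at *
  split_ifs at * with hh
  · dsimp only at *
    generalize (minimise (memOracle T) (x.dom.sort (· ≤ ·)) x).1 = z at *
    rcases refine_cases (memOracle T) z st.neg with
      ⟨L₁, s, L₂, J, h1, h2, h3, h4, -, -⟩ | ⟨h1, -⟩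
    · obtain ⟨μ, hp⟩ := Interp.exists_isPairing_of_mem h3
      have := weight_lt_of_isPairing st.pos hp h4
      rw [h2, h1]
      simp only [List.map_append, List.map_cons, List.sum_append, List.sum_cons,
        List.length_append, List.length_cons]
      omega
    · rw [h1] at hlen hcd ⊢
      have hw := weight_le st.pos (hcd z (by simp))
      simp only [List.length_append, List.length_cons, List.length_nil] at hlen
      simp only [List.map_append, List.map_cons, List.map_nil, List.sum_append, List.sum_cons,
        List.sum_nil, List.length_append, List.length_cons, List.length_nil]
      -- The length bound for the new sequence guarantees that a place was free, so the subtractions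
      -- are not truncated.
      obtain ⟨d, hd⟩ := Nat.exists_eq_add_of_le hlen
      have e1 : m * k ^ k - (st.neg.length + (0 + 1)) = d := by omega
      have e2 : m * k ^ k - st.neg.length = d + 1 := by omega
      rw [e1, e2, add_mul]
      omega
  · dsimp only
    refine Nat.add_lt_add_right (List.sum_lt_sum _ _ (fun s _ => Nat.add_le_add_left
      (Finset.card_le_card (live_cons_subset _ _ _)) _) ?_) _
    simp only [Interp.Models] at hh
    push Not at hh
    obtain ⟨C, ⟨s, hs, hb, ha, hC, hp⟩, hsat⟩ := hh
    have hCe : C = ⟨s.atoms, C.head⟩ := by rw [← hb]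
    refine ⟨s, hs, Nat.add_lt_add_left (Finset.card_lt_card ?_) _⟩
    refine ⟨live_cons_subset _ _ _, fun hsub => hsat ?_⟩
    rw [hCe]
    exact (mem_live.1 (hsub (mem_live.2 ⟨ha, fun y hy => hCe ▸ hp y hy⟩))).2 x
      List.mem_cons_self

theorem count_next_le {T : Finset (Clause σ)} {k m n : ℕ} (hk : 1 ≤ k) (hm : T.card ≤ m)
    (hT : ∀ C ∈ T, C.vars.card ≤ k) {st : State σ} (hst : Invariant T k st) {x : Interp σ}
    (hx : IsCounterexample T n st.hyp x) :
    (st.next (memOracle T) x).2 ≤ n + m * k ^ k * k ^ k := by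
  obtain ⟨hxne, hn, hdis⟩ := hx
  unfold State.next
  split_ifs with hh
  · have hneg : ¬ x.Models (T : Set (Clause σ)) := fun h => hdis ⟨fun _ => h, fun _ => hh⟩
    refine Nat.add_le_add ?_ ?_
    · refine (minimise_count_le _ _ _).trans ?_
      rwa [Finset.length_sort]
    · refine (refine_count_le (B := k ^ k) fun s hs => Interp.length_pairings_le hk
        (hst.card_dom s hs) (card_dom_minimise_le hk hT hneg)).trans ?_
      exact Nat.mul_le_mul_right _
        (length_le_of_pairwise_uncovered hk hm hT hst.negative hst.uncovered)
  · exact Nat.zero_le _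

/-- The queries asked so far plus the potential times the cost of one step never increase along a
run. -/
theorem reaches_count_le {T : Finset (Clause σ)} {k m n : ℕ} (hk : 1 ≤ k) (hm : T.card ≤ m)
    (hT : ∀ C ∈ T, C.vars.card ≤ k) {st : State σ} {q : ℕ} (h : Reaches T n st q) :
    q ≤ m * k ^ k * (2 * ∑ r : σ.Rel, k ^ σ.arity r + 1) * (1 + n + m * k ^ k * k ^ k) := by
  suffices Invariant T k st ∧
      q + potential (m * k ^ k) (2 * ∑ r : σ.Rel, k ^ σ.arity r) st *
        (1 + n + m * k ^ k * k ^ k) ≤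
      m * k ^ k * (2 * ∑ r : σ.Rel, k ^ σ.arity r + 1) * (1 + n + m * k ^ k * k ^ k) from
    (Nat.le_add_right _ _).trans this.2
  induction h with
  | start => exact ⟨⟨by simp, by simp, by simp, List.Pairwise.nil⟩, by simp [potential]⟩
  | @step st q x _ hx ih =>
    obtain ⟨hst, ih⟩ := ih
    refine ⟨invariant_next hk hT hst hx, le_trans ?_ ih⟩
    have h1 := Nat.mul_le_mul_right (1 + n + m * k ^ k * k ^ k)
      (Nat.succ_le_of_lt (potential_next_lt hk hm hT hst hx))
    have h2 := count_next_le hk hm hT hst hx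
    rw [Nat.succ_mul] at h1
    omega

end A2

/-! ### The upper bound for an arbitrary schema -/

theorem sum_pow_arity_signature_le (S : Schema) (t k : ℕ) (hk : 1 ≤ k) :
    ∑ r : (S.signature t).Rel, k ^ (S.signature t).arity r ≤
      (S.numRel + 1) * k ^ max S.maxArity t := by
  refine (Finset.sum_le_card_nsmul _ _ (k ^ max S.maxArity t) fun r _ =>
    Nat.pow_le_pow_right hk ?_).trans (le_of_eq ?_)
  · cases r with
    | none => exact le_max_right _ _
    | some r =>
      exact (Finset.le_sup (f := fun r => (S.attrs r).card) (Finset.mem_univ r)).trans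
        (le_max_left _ _)
  · rw [smul_eq_mul, Finset.card_univ]
    congr 1
    exact Fintype.card_option

/-- The constant: the target relation turns `p` into `p + 1 ≤ 2 * p`, which gives the factor 5 in
`hA'`; absorbing the equivalence query of each step gives the factor 2 in `hB`; the final
equivalence query adds 1 to the resulting 10. -/
theorem queryComplexityA2_le (S : Schema) {t m k n : ℕ} (hS : 1 ≤ S.numRel) (hk : 1 ≤ k)
    (hm : 1 ≤ m) (hn : 1 ≤ n) :
    queryComplexityA2 S t m k n ≤ (11 : ℕ) * (upperBoundA2 S t m k n : ℕ∞) := by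
  refine iSup₂_le fun T hT => iSup₂_le fun st q => iSup_le fun h => ?_
  rw [← Nat.cast_mul, Nat.cast_le]
  have hq := A2.reaches_count_le hk hT.1 (fun C hC => (hT.2 C hC).2.2) h
  have hA := sum_pow_arity_signature_le S t k hk
  unfold upperBoundA2
  set a := max S.maxArity t
  set p := S.numRel
  generalize (∑ r : (S.signature t).Rel, k ^ (S.signature t).arity r) = A at *
  have e1 : k ^ (a + 3 * k) = k ^ a * k ^ k * k ^ k * k ^ k := by
    rw [pow_add, mul_comm 3 k, pow_mul]
    ring
  rw [e1, pow_add k a k]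
  have hu : 1 ≤ k ^ a := Nat.one_le_pow _ _ hk
  have hv : 1 ≤ k ^ k := Nat.one_le_pow _ _ hk
  generalize k ^ a = u at *
  generalize k ^ k = v at *
  have hpu : 1 ≤ p * u := Nat.mul_le_mul hS hu
  have hA' : 2 * A + 1 ≤ 5 * (p * u) := by nlinarith
  have hB : 1 + n + m * v * v ≤ 2 * (n + m * v * v) := by omega
  have h1 := Nat.mul_le_mul (Nat.mul_le_mul_left (m * v) hA') hB
  have h2 : m * v * (5 * (p * u)) * (2 * (n + m * v * v)) =
      10 * (m ^ 2 * p * (u * v * v * v) + n * m * p * (u * v)) := by ring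
  have h3 : 1 ≤ n * m * p * (u * v) :=
    Nat.mul_le_mul (Nat.mul_le_mul (Nat.mul_le_mul hn hm) hS) (Nat.mul_le_mul hu hv)
  omega

/-! ## A target on which the learner needs many equivalence queries -/

namespace A2

variable {σ : Signature} (R τ : σ.Rel) (k m : ℕ)

/-- The atom `R(0, …, k - 1, 0, …, 0, 1, 0, …, 0)` with the isolated `1` at position `k + j`. -/
def patternAtom (j : ℕ) : Atom σ :=
  ⟨R, fun i => if (i : ℕ) < k then i else if (i : ℕ) = k + j then 1 else 0⟩

/-- The clause `τ(0, …, 0) ← R(0, …, k - 1, …)`. -/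
def patternClause (j : ℕ) : Clause σ := ⟨{patternAtom R k j}, ⟨τ, fun _ => 0⟩⟩

open Classical in
/-- The target consisting of the first `m` pattern clauses. -/
noncomputable def patternTarget : Finset (Clause σ) :=
  (Finset.range m).image (patternClause R τ k)

variable {R τ k m}

theorem mem_patternTarget {C : Clause σ} :
    C ∈ patternTarget R τ k m ↔ ∃ j < m, patternClause R τ k j = C := by
  simp [patternTarget]

theorem card_patternTarget_le : (patternTarget R τ k m).card ≤ m := by
  classical exact Finset.card_image_le.trans (Finset.card_range m).le

theorem patternAtom_args_subset (hk : 2 ≤ k) (j : ℕ) :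
    (patternAtom R k j).args ⊆ Finset.range k := by
  rw [Atom.args_subset_iff]
  intro i
  simp only [patternAtom, Finset.mem_range]
  split_ifs <;> omega

theorem mem_patternAtom_args (hR : k ≤ σ.arity R) {v : ℕ} (hv : v < k) (j : ℕ) :
    v ∈ (patternAtom R k j).args :=
  Atom.mem_args.2 ⟨⟨v, hv.trans_le hR⟩, by simp [patternAtom, hv]⟩

theorem card_vars_patternClause_le (hk : 2 ≤ k) (j : ℕ) :
    (patternClause R τ k j).vars.card ≤ k := by
  refine (Finset.card_le_card (t := Finset.range k) ?_).trans (Finset.card_range k).le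
  simp only [Clause.vars, patternClause, Finset.singleton_biUnion]
  refine Finset.union_subset (patternAtom_args_subset hk j) ?_
  rw [Atom.args_subset_iff]
  intro i
  simpa using (by omega : 0 < k)

/-- The first `k` positions list all variables and force the substitution to be the identity on
them. The isolated `1` then reveals the index; for this, `1` must be among the fixed variables,
whence `2 ≤ k`. -/
theorem patternAtom_map_eq (hR : k + m ≤ σ.arity R) {i j : ℕ} (hi : i < m)
    {θ : ℕ → ℕ} (h : (patternAtom R k i).map θ = patternAtom R k j) :
    (∀ v < k, θ v = v) ∧ (2 ≤ k → i = j) := by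
  have h' : ∀ p : Fin (σ.arity R), θ ((patternAtom R k i).2 p) = (patternAtom R k j).2 p :=
    fun p => congrFun (eq_of_heq (Sigma.mk.inj_iff.1 h).2) p
  have hid : ∀ v < k, θ v = v := fun v hv => by
    simpa [patternAtom, hv] using h' ⟨v, by omega⟩
  refine ⟨hid, fun hk => ?_⟩
  have := h' ⟨k + i, by omega⟩
  simp only [patternAtom, if_neg (not_lt.2 (Nat.le_add_right k i)), if_true, hid 1 hk] at this
  split_ifs at this
  omega

variable (R k) in
/-- The negative example with the single true atom `patternAtom R k j`. -/
def patternInterp (hk : 2 ≤ k) (j : ℕ) : Interp σ where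
  dom := Finset.range k
  atoms := {patternAtom R k j}
  wf := by
    intro a ha
    rw [Finset.mem_singleton.1 ha]
    exact patternAtom_args_subset hk j

theorem models_patternTarget_of_atoms_eq_empty {x : Interp σ} (h : x.atoms = ∅) :
    x.Models (patternTarget R τ k m : Set (Clause σ)) := by
  intro C hC θ _ hb
  obtain ⟨j, -, rfl⟩ := mem_patternTarget.1 hC
  have := hb _ (Finset.mem_singleton_self _)
  simp [h] at this

theorem reaches_patternInterps (hRτ : R ≠ τ) (hk : 2 ≤ k) (hR : k + m ≤ σ.arity R) {n : ℕ}
    (hn : k ≤ n) {j : ℕ} (hj : j ≤ m) :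
    ∃ q, Reaches (patternTarget R τ k m) n
      ⟨(List.range j).map (patternInterp R k hk), []⟩ q := by
  induction j with
  | zero => exact ⟨0, .start⟩
  | succ j ih =>
    obtain ⟨q, hq⟩ := ih (by omega)
    set st : State σ := ⟨(List.range j).map (patternInterp R k hk), []⟩ with hst
    set x := patternInterp R k hk j with hxdef
    -- The clauses hold vacuously: their bodies are pattern atoms of smaller index, which have no
    -- instance in `x`.
    have hhyp : x.Models st.hyp := by
      rintro C ⟨s, hs, hb, -, -, -⟩ θ - hθ
      obtain ⟨i, hi, rfl⟩ := List.mem_map.1 hs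
      rw [hb] at hθ
      have := patternAtom_map_eq hR (by simp at hi; omega)
        (Finset.mem_singleton.1 (hθ _ (Finset.mem_singleton_self _)))
      have h2 := this.2 hk
      simp at hi
      omega
    have hneg : ¬ x.Models (patternTarget R τ k m : Set (Clause σ)) := by
      intro h
      have hid : (patternAtom R k j).map (fun v => if v < k then v else 0) =
          patternAtom R k j := Atom.map_eq_self fun v hv =>
        if_pos (Finset.mem_range.1 (patternAtom_args_subset hk j hv))
      have := h _ (mem_patternTarget.2 ⟨j, hj, rfl⟩) (fun v => if v < k then v else 0)
        (fun v => by
          simp only [hxdef, patternInterp, Finset.mem_range]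
          split_ifs <;> omega)
        (fun a ha => by
          rw [Finset.mem_singleton.1 ha, hid]
          exact Finset.mem_singleton_self _)
      exact hRτ (congrArg Sigma.fst (Finset.mem_singleton.1 this)).symm
    -- The only true atom contains all `k` objects, so any drop leaves no true atom and a positive
    -- example.
    have hmin : (minimise (memOracle (patternTarget R τ k m)) (x.dom.sort (· ≤ ·)) x).1 = x := by
      refine minimise_eq_self fun o ho => memOracle_eq_true.2
        (models_patternTarget_of_atoms_eq_empty (Finset.filter_eq_empty_iff.2 fun a ha => ?_))
      rw [Finset.mem_singleton.1 ha, not_not]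
      exact mem_patternAtom_args (by omega)
        (Finset.mem_range.1 ((Finset.mem_sort _).1 ho)) j
    have hnext : (st.next (memOracle (patternTarget R τ k m)) x).1 =
        ⟨(List.range (j + 1)).map (patternInterp R k hk), []⟩ := by
      unfold State.next
      rw [if_pos hhyp]
      dsimp only
      rw [hmin, refine_eq_append, List.range_succ, List.map_append]
      · rfl
      -- An atom of a pairing would be a pattern atom that the matching maps to one of different
      -- index. All pairings are therefore empty, hence positive, and `x` is appended.
      · intro s hs J hJ
        obtain ⟨i, hi, rfl⟩ := List.mem_map.1 hs
        obtain ⟨μ, hp⟩ := Interp.exists_isPairing_of_mem hJ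
        refine memOracle_eq_true.2 (models_patternTarget_of_atoms_eq_empty
          (Finset.eq_empty_of_forall_notMem fun a ha => ?_))
        obtain ⟨h1, -, h2⟩ := (hp.mem_atoms a).1 ha
        rw [Finset.mem_singleton.1 h1] at h2
        have := (patternAtom_map_eq hR (by simp at hi; omega) (Finset.mem_singleton.1 h2)).2 hk
        simp at hi
        omega
    refine ⟨_, hnext ▸ hq.step (x := x) ⟨⟨0, ?_⟩, ?_, fun h => hneg (h.1 hhyp)⟩⟩
    · exact Finset.mem_range.2 (by omega)
    · simpa [hxdef, patternInterp] using hn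

/-! ### Positive counterexamples that each refute a single clause with a free head -/

variable (R k m) in
/-- The atom is an instance of one of the first `m` pattern atoms. -/
def IsPatternInstance (a : Atom σ) : Prop := ∃ i < m, ∃ θ, a = (patternAtom R k i).map θ

open Classical in
variable (R k m) in
/-- The positive example over `k` objects that has all atoms except `b` and the instances of the
pattern atoms other than `patternAtom R k j` itself. -/
noncomputable def posInterp (j : ℕ) (b : Atom σ) : Interp σ where
  dom := Finset.range k
  atoms := (atomsOver σ (Finset.range k)).filter fun a =>
    a ≠ b ∧ (a = patternAtom R k j ∨ ¬ IsPatternInstance R k m a)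
  wf _ ha := mem_atomsOver.1 (Finset.mem_filter.1 ha).1

theorem mem_posInterp {j : ℕ} {a b : Atom σ} : a ∈ (posInterp R k m j b).atoms ↔
    a.args ⊆ Finset.range k ∧ a ≠ b ∧
      (a = patternAtom R k j ∨ ¬ IsPatternInstance R k m a) := by
  simp [posInterp, mem_atomsOver]

open Classical in
variable (R k m) in
/-- The `R`-atoms over `k` objects that are not instances of the pattern atoms. -/
noncomputable def freeAtoms : Finset (Atom σ) :=
  (atomsOver σ (Finset.range k)).filter fun a => a.1 = R ∧ ¬ IsPatternInstance R k m a

theorem mem_freeAtoms {a : Atom σ} : a ∈ freeAtoms R k m ↔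
    a.args ⊆ Finset.range k ∧ a.1 = R ∧ ¬ IsPatternInstance R k m a := by
  simp [freeAtoms, mem_atomsOver]

/-- A pattern instance over `k` objects is determined by the index of the pattern and a self-map of
the `k` objects, so at most `m * k ^ k` of the `R`-atoms are not free. -/
theorem le_card_freeAtoms (hk : 2 ≤ k) (hR : k ≤ σ.arity R) :
    k ^ σ.arity R ≤ (freeAtoms R k m).card + m * k ^ k := by
  classical
  let A : Finset (Atom σ) := (Fintype.piFinset fun _ : Fin (σ.arity R) => Finset.range k).image
    fun f => ⟨R, f⟩
  let B : Finset (Atom σ) := (Finset.range m ×ˢ (Finset.univ : Finset (Fin k → Fin k))).image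
    fun p => (patternAtom R k p.1).map fun v => if h : v < k then p.2 ⟨v, h⟩ else 0
  have hA : A.card = k ^ σ.arity R := by
    rw [Finset.card_image_of_injective, Fintype.card_piFinset]
    · simp
    · intro f g h
      exact eq_of_heq (Sigma.mk.inj_iff.1 h).2
  have hB : B.card ≤ m * k ^ k := by
    refine Finset.card_image_le.trans (le_of_eq ?_)
    simp [Finset.card_product]
  have hAB : A ⊆ freeAtoms R k m ∪ B := by
    intro a ha
    obtain ⟨f, hf, rfl⟩ := Finset.mem_image.1 ha
    have hf' : Atom.args (⟨R, f⟩ : Atom σ) ⊆ Finset.range k :=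
      Atom.args_subset_iff.2 fun i => (Fintype.mem_piFinset.1 hf) i
    by_cases hp : IsPatternInstance R k m ⟨R, f⟩
    · obtain ⟨i, hi, θ, h⟩ := hp
      refine Finset.mem_union_right _ ?_
      have hθ : ∀ v < k, θ v < k := fun v hv => by
        rw [h, Atom.args_map] at hf'
        exact Finset.mem_range.1
          (hf' (Finset.mem_image_of_mem θ (mem_patternAtom_args hR hv i)))
      refine Finset.mem_image.2 ⟨(i, fun v => ⟨θ v, hθ v v.2⟩), by simpa using hi, ?_⟩
      dsimp only
      rw [h]
      exact Atom.map_congr fun v hv =>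
        dif_pos (Finset.mem_range.1 (patternAtom_args_subset hk i hv))
    · exact Finset.mem_union_left _ (mem_freeAtoms.2 ⟨hf', rfl, hp⟩)
  calc k ^ σ.arity R = A.card := hA.symm
    _ ≤ _ := (Finset.card_le_card hAB).trans (Finset.card_union_le _ _)
    _ ≤ _ := Nat.add_le_add_left hB _

/-- All `τ`-atoms over the domain are true, since neither `b` nor any pattern instance is a
`τ`-atom. -/
theorem posInterp_models (hRτ : R ≠ τ) {j : ℕ} {b : Atom σ} (hb : b.1 = R) :
    (posInterp R k m j b).Models (patternTarget R τ k m : Set (Clause σ)) := by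
  intro C hC θ hθ _
  obtain ⟨i, -, rfl⟩ := mem_patternTarget.1 hC
  refine mem_posInterp.2 ⟨Atom.args_subset_iff.2 fun _ => hθ _, ?_, Or.inr ?_⟩
  · rintro h
    exact hRτ (hb.symm.trans (congrArg Sigma.fst h).symm)
  · rintro ⟨i', -, η, h⟩
    exact hRτ (congrArg Sigma.fst h).symm

/-- The only true pattern instance is pattern atom `j` itself. A body can be matched only if it is
that atom, and then only by the identity, which leaves the head unchanged; `b` is the only false
free atom. -/
theorem posInterp_sat_iff (hk : 2 ≤ k) (hR : k + m ≤ σ.arity R) {i j : ℕ} (hi : i < m)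
    {b c : Atom σ} (hb : b ∈ freeAtoms R k m) (hc : c ∈ freeAtoms R k m) :
    (posInterp R k m j b).Sat ⟨{patternAtom R k i}, c⟩ ↔ ¬ (i = j ∧ c = b) := by
  rw [mem_freeAtoms] at hb hc
  constructor
  · rintro h ⟨rfl, rfl⟩
    have hid : ∀ a : Atom σ, a.args ⊆ Finset.range k →
        a.map (fun v => if v < k then v else 0) = a := fun a ha =>
      Atom.map_eq_self fun v hv => if_pos (Finset.mem_range.1 (ha hv))
    have hp := patternAtom_args_subset (R := R) hk i
    have := h (fun v => if v < k then v else 0) (fun v => by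
        simp only [posInterp, Finset.mem_range]
        split_ifs <;> omega) (fun a ha => by
        rw [Finset.mem_singleton.1 ha, hid _ hp]
        refine mem_posInterp.2 ⟨hp, fun e => hb.2.2 ⟨i, hi, id, e.symm⟩, Or.inl rfl⟩)
    rw [hid _ hb.1, mem_posInterp] at this
    exact this.2.1 rfl
  · intro h θ hθ hbody
    have h1 := mem_posInterp.1 (hbody _ (Finset.mem_singleton_self _))
    rcases h1.2.2 with h2 | h2
    · have h3 := patternAtom_map_eq hR hi h2
      have h4 : c.map θ = c := Atom.map_eq_self fun v hv =>
        h3.1 v (Finset.mem_range.1 (hc.1 hv))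
      rw [h4]
      exact mem_posInterp.2 ⟨hc.1, fun e => h ⟨h3.2 hk, e⟩, Or.inr hc.2.2⟩
    · exact absurd ⟨i, hi, θ, rfl⟩ h2

/-- The pairs (body index, free head) can be refuted in any order, since no counterexample removes
the clause of another pair. Each pair costs one equivalence query. -/
theorem reaches_posInterps (hRτ : R ≠ τ) (hk : 2 ≤ k) (hR : k + m ≤ σ.arity R) {n : ℕ}
    (hn : k ≤ n) {P : List (ℕ × Atom σ)} (hP : P.Nodup)
    (hP' : ∀ p ∈ P, p.1 < m ∧ p.2 ∈ freeAtoms R k m) :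
    ∃ q, P.length ≤ q ∧ Reaches (patternTarget R τ k m) n
      ⟨(List.range m).map (patternInterp R k hk), P.map fun p => posInterp R k m p.1 p.2⟩ q := by
  induction P with
  | nil =>
    obtain ⟨q, hq⟩ := reaches_patternInterps hRτ hk hR hn le_rfl
    exact ⟨q, Nat.zero_le _, hq⟩
  | cons p P ih =>
    obtain ⟨hp, hnd⟩ := List.nodup_cons.1 hP
    obtain ⟨q, hq, hr⟩ := ih hnd fun p hp => hP' p (List.mem_cons_of_mem _ hp)
    obtain ⟨hp1, hp2⟩ := hP' p List.mem_cons_self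
    have hp2' := mem_freeAtoms.1 hp2
    have hhyp : ¬ (posInterp R k m p.1 p.2).Models (State.hyp
        ⟨(List.range m).map (patternInterp R k hk),
          P.map fun p => posInterp R k m p.1 p.2⟩) := by
      intro h
      refine (posInterp_sat_iff hk hR hp1 hp2 hp2).1 (h ⟨{patternAtom R k p.1}, p.2⟩
        ⟨patternInterp R k hk p.1, ?_, rfl, hp2'.1, ?_, ?_⟩) ⟨rfl, rfl⟩
      · exact List.mem_map_of_mem (by simpa using hp1)
      · intro h
        exact hp2'.2.2 ⟨p.1, hp1, id, Finset.mem_singleton.1 h⟩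
      · intro y hy
        obtain ⟨p', hp', rfl⟩ := List.mem_map.1 hy
        refine (posInterp_sat_iff hk hR hp1 (hP' p' (List.mem_cons_of_mem _ hp')).2 hp2).2 ?_
        rintro ⟨e1, e2⟩
        exact hp (Prod.ext e1 e2 ▸ hp')
    refine ⟨_, ?_, by
      simpa only [State.next, if_neg hhyp, List.map_cons] using hr.step (x := posInterp R k m p.1 p.2)
        ⟨⟨0, Finset.mem_range.2 (by omega)⟩, by simpa [posInterp] using hn,
          fun h => hhyp (h.2 (posInterp_models hRτ hp2'.2.1))⟩⟩
    simpa using hq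

theorem exists_reaches (hRτ : R ≠ τ) (hk : 2 ≤ k) (hR : k + m ≤ σ.arity R) {n : ℕ}
    (hn : k ≤ n) : ∃ st q, Reaches (patternTarget R τ k m) n st q ∧
      m * k ^ σ.arity R ≤ q + m * (m * k ^ k) := by
  obtain ⟨q, hq, h⟩ := reaches_posInterps hRτ hk hR hn
    (P := (Finset.range m ×ˢ freeAtoms R k m).toList) (Finset.nodup_toList _)
    (fun p hp => by simpa using hp)
  refine ⟨_, q, h, ?_⟩
  rw [Finset.length_toList, Finset.card_product, Finset.card_range] at hq
  have := Nat.mul_le_mul_left m (le_card_freeAtoms (R := R) (m := m) hk (by omega : k ≤ σ.arity R))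
  rw [mul_add] at this
  omega

end A2

/-- The heads are target atoms with all arguments equal, so the bound does not depend on `t`. -/
theorem le_queryComplexityA2 {S : Schema} (r : S.Rel) {t m k n : ℕ} (hk : 2 ≤ k)
    (hr : k + m ≤ (S.attrs r).card) (hn : k ≤ n) :
    ((m * k ^ (S.attrs r).card : ℕ) : ℕ∞) ≤
      queryComplexityA2 S t m k n + (m * (m * k ^ k) : ℕ) := by
  obtain ⟨st, q, h, hq⟩ := A2.exists_reaches (σ := S.signature t) (R := some r) (τ := none)
    (Option.some_ne_none r) hk hr hn
  have hT : A2.patternTarget (σ := S.signature t) (some r) none k m ∈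
      hornDefinitions S t m k := by
    refine ⟨A2.card_patternTarget_le, fun C hC => ?_⟩
    obtain ⟨j, -, rfl⟩ := A2.mem_patternTarget.1 hC
    refine ⟨rfl, fun a ha => ?_, A2.card_vars_patternClause_le hk j⟩
    rw [Finset.mem_singleton.1 ha]
    exact Option.some_ne_none r
  have h1 : ((q + 1 : ℕ) : ℕ∞) ≤ queryComplexityA2 S t m k n :=
    le_iSup₂_of_le _ hT (le_iSup₂_of_le st q (le_iSup_of_le h le_rfl))
  calc ((m * k ^ (S.attrs r).card : ℕ) : ℕ∞) ≤ ((q + 1 + m * (m * k ^ k) : ℕ) : ℕ∞) :=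
        Nat.cast_le.2 (hq.trans (by omega))
    _ = ((q + 1 : ℕ) : ℕ∞) + ((m * (m * k ^ k) : ℕ) : ℕ∞) := Nat.cast_add _ _
    _ ≤ _ := add_le_add_left h1 _

/-! ## The wide schema and its decomposition -/

theorem numRel_wideSchema (l : ℕ) : (wideSchema l).numRel = 1 := Fintype.card_unit

theorem maxArity_wideSchema (l : ℕ) : (wideSchema l).maxArity = l := by
  refine (Finset.sup_const (Finset.univ_nonempty (α := Unit)) _).trans (Finset.card_range l)

theorem numRel_binarySchema (l : ℕ) : (binarySchema l).numRel = l - 1 := Fintype.card_fin _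

theorem maxArity_binarySchema {l : ℕ} (hl : 2 ≤ l) : (binarySchema l).maxArity = 2 := by
  have h : ∀ i : Fin (l - 1), ((binarySchema l).attrs i).card = 2 := fun i =>
    Finset.card_pair (Nat.succ_ne_zero i).symm
  have : Nonempty (Fin (l - 1)) := ⟨⟨0, by omega⟩⟩
  exact (Finset.sup_congr rfl fun i _ => h i).trans (Finset.sup_const Finset.univ_nonempty 2)

theorem allFDs_wideSchema (l : ℕ) : (wideSchema l).allFDs = (binarySchema l).allFDs := by
  ext f
  constructor
  · rintro ⟨-, i, h1, h2, rfl⟩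
    refine ⟨(⟨i - 1, by omega⟩ : Fin (l - 1)), ?_⟩
    change _ = (({0}, {i - 1 + 1}) : Finset ℕ × Finset ℕ)
    rw [Nat.sub_add_cancel h1]
  · rintro ⟨i, hi⟩
    have hlt : (i : Fin (l - 1)).1 < l - 1 := (i : Fin (l - 1)).2
    exact ⟨(), (i : Fin (l - 1)).1 + 1, by omega, by omega, hi⟩

theorem isVerticalDecomposition_binarySchema {l : ℕ} (hl : 3 ≤ l) :
    (wideSchema l).IsVerticalDecomposition (binarySchema l) := by
  have hmem : ∀ (A : ℕ) (i : Fin (l - 1)),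
      A ∈ (binarySchema l).attrs i ↔ A = 0 ∨ A = (i : ℕ) + 1 := fun A i => by
    simp [binarySchema]
  refine ⟨(), fun _ => rfl, ⟨(⟨0, by omega⟩ : Fin (l - 1))⟩, ?_, fun X Y => ?_, {0}, fun A => ?_,
    Finset.singleton_nonempty 0, ?_, fun i => ?_, fun i j hij => ?_⟩
  · ext A
    simp only [Finset.mem_biUnion, Finset.mem_univ, true_and]
    refine Iff.trans (Finset.mem_range (m := A) (n := l)) ⟨fun hA => ?_, ?_⟩
    · refine ⟨(⟨A - 1, by omega⟩ : Fin (l - 1)), (hmem _ _).2 ?_⟩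
      dsimp only
      omega
    · rintro ⟨i, hi⟩
      have hlt : (i : Fin (l - 1)).1 < l - 1 := (i : Fin (l - 1)).2
      have := (hmem A i).1 hi
      omega
  · rw [allFDs_wideSchema]
  · rw [Finset.mem_singleton]
    refine ⟨fun h i => (hmem _ i).2 (Or.inl h), fun h => ?_⟩
    -- Two different relations are needed to exclude every common attribute except `0`; this is
    -- where `3 ≤ l` enters.
    have h0 := (hmem A ⟨0, by omega⟩).1 (h _)
    have h1 := (hmem A ⟨1, by omega⟩).1 (h _)
    dsimp only at h0 h1
    omega
  · refine Finset.ssubset_iff_subset_ne.2 ⟨?_, fun h => ?_⟩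
    · exact Finset.singleton_subset_iff.2 (Finset.mem_range.2 (by omega))
    · have := congrArg Finset.card h
      rw [Finset.card_singleton] at this
      have h2 : 1 = (Finset.range l).card := this
      rw [Finset.card_range] at h2
      omega
  -- Augmenting `A_0 → A_i` by `A_0` itself gives the whole attribute set on the right.
  · have h := (FDClosure.base (F := (binarySchema l).allFDs) (X := {0})
      (Y := {(i : Fin (l - 1)).1 + 1}) ⟨i, rfl⟩).augment {0}
    rwa [Finset.union_self, Finset.union_comm] at h
  · rw [Finset.sort_singleton]
    exact ⟨i, j, hij, rfl⟩

theorem upperBoundA2_binarySchema {l : ℕ} (hl : 2 ≤ l) (t m k n : ℕ) :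
    upperBoundA2 (binarySchema l) t m k n =
      (l - 1) * (m ^ 2 * k ^ (max 2 t + 3 * k) + n * m * k ^ (max 2 t + k)) := by
  rw [upperBoundA2, numRel_binarySchema, maxArity_binarySchema hl]
  ring

theorem lowerBoundA2_wideSchema (l m k : ℕ) :
    lowerBoundA2 (wideSchema l) m k = m * k ^ l := by
  rw [lowerBoundA2, numRel_wideSchema, maxArity_wideSchema, mul_one]

/-! ### Comparison of the two bounds -/

theorem upperBoundA2_isLittleO_lowerBoundA2 {k m : ℕ} (hk : 2 ≤ k) (hm : 1 ≤ m) (t n : ℕ) :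
    (fun l : ℕ => (upperBoundA2 (binarySchema l) t m k n : ℝ)) =o[Filter.atTop]
      fun l : ℕ => (lowerBoundA2 (wideSchema l) m k : ℝ) := by
  have h1 : (fun l : ℕ => (upperBoundA2 (binarySchema l) t m k n : ℝ)) =O[Filter.atTop]
      fun l : ℕ => (l : ℝ) ^ 1 := by
    refine Asymptotics.IsBigO.of_bound
      ((m ^ 2 * k ^ (max 2 t + 3 * k) + n * m * k ^ (max 2 t + k) : ℕ) : ℝ) ?_
    filter_upwards [Filter.eventually_ge_atTop 2] with l hl
    rw [upperBoundA2_binarySchema hl, pow_one, RCLike.norm_natCast, RCLike.norm_natCast,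
      ← Nat.cast_mul, Nat.cast_le, mul_comm]
    exact Nat.mul_le_mul_left _ (Nat.sub_le _ _)
  have h2 : (fun l : ℕ => (k : ℝ) ^ l) =O[Filter.atTop]
      fun l : ℕ => (lowerBoundA2 (wideSchema l) m k : ℝ) := by
    refine Asymptotics.IsBigO.of_bound 1 (Filter.Eventually.of_forall fun l => ?_)
    rw [lowerBoundA2_wideSchema, one_mul, ← Nat.cast_pow, RCLike.norm_natCast,
      RCLike.norm_natCast, Nat.cast_le]
    exact Nat.le_mul_of_pos_left _ hm
  exact h1.trans_isLittleO ((isLittleO_pow_const_const_pow_of_one_lt 1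
    (by exact_mod_cast hk : (1 : ℝ) < k)).trans_isBigO h2)

/-- The condition on `l` makes the loss from pattern instances at most half of the main term: `2 * m
≤ k ^ (2 * m)`, hence `2 * (m * k ^ k) ≤ k ^ l`. This gives the constant 2. -/
theorem lowerBoundA2_wideSchema_le {k m l t n : ℕ} (hk : 2 ≤ k) (hl : k + 2 * m ≤ l)
    (hn : k ≤ n) :
    (lowerBoundA2 (wideSchema l) m k : ℕ∞) ≤ (2 : ℕ) * queryComplexityA2 (wideSchema l) t m k n := by
  have hcard : ((wideSchema l).attrs ()).card = l := Finset.card_range l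
  have h := le_queryComplexityA2 (S := wideSchema l) () (t := t) (m := m) hk
    (by rw [hcard]; omega) hn
  rw [hcard] at h
  rw [lowerBoundA2_wideSchema]
  have h2 : 2 * (m * k ^ k) ≤ k ^ l := by
    calc 2 * (m * k ^ k) = k ^ k * (2 * m) := by ring
      _ ≤ k ^ k * k ^ (2 * m) := Nat.mul_le_mul_left _ (Nat.lt_pow_self hk).le
      _ = k ^ (k + 2 * m) := (pow_add _ _ _).symm
      _ ≤ k ^ l := Nat.pow_le_pow_right (by omega) hl
  generalize queryComplexityA2 (wideSchema l) t m k n = Q at *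
  induction Q using ENat.recTopCoe with
  | top => rw [ENat.mul_top (by simp)]; exact le_top
  | coe Q =>
    have h3 : m * k ^ l ≤ Q + m * (m * k ^ k) := by exact_mod_cast h
    have h4 := Nat.mul_le_mul_left m h2
    have h5 : m * k ^ l ≤ 2 * Q := by
      rw [Nat.mul_left_comm] at h4
      omega
    exact_mod_cast h5

theorem mainTheorem4 :
    -- for l ≥ 3, the l - 1 binary relations are a vertical decomposition of the l-ary relation
    (∀ l : ℕ, 3 ≤ l →
      (wideSchema l).numRel = 1 ∧ (wideSchema l).maxArity = l ∧
      (binarySchema l).numRel = l - 1 ∧ (binarySchema l).maxArity = 2 ∧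
      (wideSchema l).IsVerticalDecomposition (binarySchema l)) ∧
    -- the lower bound over the wide schema, with an absolute constant
    (∃ c : ℕ, ∀ k m : ℕ, 2 ≤ k → 1 ≤ m → ∀ᶠ l : ℕ in Filter.atTop, ∀ t n : ℕ, k ≤ n →
      (lowerBoundA2 (wideSchema l) m k : ℕ∞) ≤ c * queryComplexityA2 (wideSchema l) t m k n) ∧
    -- the upper bound over the decomposition, with an absolute constant
    (∃ c : ℕ, ∀ k m : ℕ, 2 ≤ k → 1 ≤ m → ∀ l : ℕ, 3 ≤ l → ∀ t n : ℕ, k ≤ n →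
      queryComplexityA2 (binarySchema l) t m k n ≤ c * (upperBoundA2 (binarySchema l) t m k n : ℕ∞)) ∧
    -- the lower bound over the wide schema asymptotically exceeds the upper bound
    (∀ k m : ℕ, 2 ≤ k → 1 ≤ m → ∀ t n : ℕ, k ≤ n →
      (fun l : ℕ => (upperBoundA2 (binarySchema l) t m k n : ℝ)) =o[Filter.atTop]
        fun l : ℕ => (lowerBoundA2 (wideSchema l) m k : ℝ)) := by

  refine ⟨fun l hl => ⟨numRel_wideSchema l, maxArity_wideSchema l, numRel_binarySchema l,
      maxArity_binarySchema (by omega), isVerticalDecomposition_binarySchema hl⟩,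
    ⟨2, fun k m hk _ => ?_⟩, ⟨11, fun k m hk hm l hl t n hn => ?_⟩,
    fun k m hk hm t n _ => upperBoundA2_isLittleO_lowerBoundA2 hk hm t n⟩
  · filter_upwards [Filter.eventually_ge_atTop (k + 2 * m)] with l hl t n hn
    exact lowerBoundA2_wideSchema_le hk hl hn
  · exact queryComplexityA2_le _ (by rw [numRel_binarySchema]; omega) (by omega) hm (by omega)
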